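/- A \emph{real algebraic curve} in $\mathbb{R}^2$ is a set $C\subset\mathbb{R}^2$ that is the common zero set of finitely many polynomials in $\mathbb{R}[x,y]$ and has real dimension $1$, i.e. the ring $\mathbb{R}[x,y]/I(C)$ has Krull dimension $1$, where $I(C)$ is the ideal of all polynomials vanishing on $C$ (so $C$ may be reducible and may have isolated points). Every such $C$ is the zero set of a single polynomial, and its \emph{degree} is the minimum degree of a polynomial $f\in\mathbb{R}[x,y]$ whose zero set is $C$. For a finite set $\mathcal P\subset\mathbb{R}^2$ and a finite set $\mathcal C$ of curves let $I(\mathcal P,\mathcal C)=\{(p,C)\in\mathcal P\times\mathcal C: p\in C\}$. There is an absolute constant $K>0$ such that the following two statements hold for all finite sets $A,B\subset\mathbb{R}$ with $\mathcal P:=A\times B$, all non-negative integers $d,M$, and every finite set $\mathcal C$ of real algebraic curves in $\mathbb{R}^2$ of degree at most $d$ such that any two distinct points of $\mathcal P$ are contained in at most $M$ curves of $\mathcal C$. (i) If no curve of $\mathcal C$ contains a horizontal or vertical line, $d^4|\mathcal C|\le M|\mathcal P|^2$, $|A|\le|B|$, and $d|\mathcal C|\ge M|B|^2/|A|$ (a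 condition that is void if $A=\emptyset$), then $$|I(\mathcal P,\mathcal C)|\le K\, d^{2/3}M^{1/3}|\mathcal P|^{2/3}|\mathcal C|^{2/3}.$$ (ii) If $|A|=|B|$ (and with no other condition on sizes or on lines), then $$|I(\mathcal P,\mathcal C)|\le K\left(d^{2/3}M^{1/3}|\mathcal P|^{2/3}|\mathcal C|^{2/3}+M(\log M+\log d)|\mathcal P|+d^2|\mathcal C|\right),$$ where $\log$ is the natural logarithm and $\log 0$ is read as $0$. -/

import Mathlib

noncomputable section

namespace RealIncidence

/-- The real plane `ℝ²`; only its set of points matters here. -/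
abbrev Plane : Type := Fin 2 → ℝ

/-- Real polynomials in two variables. -/
abbrev Poly2 : Type := MvPolynomial (Fin 2) ℝ

/-- The common zero set in `ℝ²` of a finite family of real polynomials. -/
def zeroSet (S : Finset Poly2) : Set Plane :=
  {p | ∀ f ∈ S, MvPolynomial.eval p f = 0}

/-- A real variety in `ℝ²`: the zero set of finitely many real polynomials. -/
def IsRealVariety (W : Set Plane) : Prop :=
  ∃ S : Finset Poly2, W = zeroSet S

/-- The real dimension of `W ⊆ ℝ²`: the Krull dimension of the coordinate ring `ℝ[x,y]/I(W)`,
where `I(W)` is the ideal of all real polynomials vanishing on `W`. -/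
def realDim (W : Set Plane) : WithBot ℕ∞ :=
  ringKrullDim (Poly2 ⧸ MvPolynomial.vanishingIdeal ℝ W)

/-- A real algebraic curve in `ℝ²`: a real variety of real dimension one. It may be reducible and
may have isolated points. -/
def IsRealCurve (W : Set Plane) : Prop :=
  IsRealVariety W ∧ realDim W = 1

/-- The degree of a real algebraic curve in `ℝ²`: the minimum degree of a single polynomial
whose zero set it is. -/
def curveDegree (W : Set Plane) : ℕ :=
  sInf {n | ∃ f : Poly2, W = zeroSet {f} ∧ f.totalDegree = n}

/-- `W` contains a horizontal line `y = b` or a vertical line `x = a`. -/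
def ContainsAxisParallelLine (W : Set Plane) : Prop :=
  (∃ b : ℝ, {p : Plane | p 1 = b} ⊆ W) ∨ (∃ a : ℝ, {p : Plane | p 0 = a} ⊆ W)

/-- The Cartesian product `A × B`, as a finite set of points of `ℝ²`. -/
def grid (A B : Finset ℝ) : Finset Plane :=
  (A ×ˢ B).map (finTwoArrowEquiv ℝ).symm.toEmbedding

open Classical in
/-- The set of incidences `{(p, c) ∈ P × C : p ∈ c}`. -/
def incidences (P : Finset Plane) (C : Finset (Set Plane)) : Finset (Plane × Set Plane) :=
  (P ×ˢ C).filter fun x => x.1 ∈ x.2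

open Classical in
/-- Any two distinct points of `P` are contained in at most `M` members of `C`. -/
def AtMostThroughTwo (P : Finset Plane) (C : Finset (Set Plane)) (M : ℕ) : Prop :=
  ∀ p ∈ P, ∀ q ∈ P, p ≠ q → (C.filter fun c => p ∈ c ∧ q ∈ c).card ≤ M

end RealIncidence

end

noncomputable section

namespace RealIncidence

open MvPolynomial

/-! ### A Bézout bound for the number of common zeros -/

/-! The proof partitions the grid elementarily. Cut `A` and `B` into `r` consecutive blocks each, so
that the plane splits into `r ^ 2` boxes holding about `|P| / r ^ 2` points each. A curve of degree
`d` without axis-parallel lines meets at most `4rd + d ^ 2` boxes (`card_cells_le`): either it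
crosses a side of the box, and each cutting line carries at most `d` of its points, or it meets the
box without touching the boundary, and then its rightmost point inside is a common zero of `f` and
`∂f/∂y`. After passing to an equation of minimal degree, Bézout leaves at most `d ^ 2` such points.

On each curve, one point per visited box is counted directly and every other point is charged to a
pair of points in the same box; each pair is charged by at most `M` curves. Hence `I ≤ |C| (4rd + d
^ 2) + 4 M |P| ^ 2 / r ^ 2` (`sum_card_grid_le`). Balancing with `r ^ 3 ≈ M |P| ^ 2 / (d |C|)` gives
(i): the size hypotheses say exactly that this value lies between `d` and `|A|`.

For (ii), if `d ^ 4 |C| ≥ M |P| ^ 2` then Cauchy–Schwarz gives `O(d ^ 2 |C|)`. Otherwise each curve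
is split into a part without axis-parallel lines and at most `d` lines in each direction. A line
through at least two grid points lies on at most `M` curves, and together with the bound `d` per
curve this puts the lines under the main term (`mul_le_mainTerm`). The remainder is covered by (i),
or by the trivial bound and the same interpolation. The logarithmic term is never used: it is only
added at the end, being nonnegative. -/

theorem two_mul_card_degree_le (k : ℕ) :
    2 * Nat.card {n : Fin 2 →₀ ℕ | n.degree ≤ k} = (k + 1) * (k + 2) := by
  have e : {n : Fin 2 →₀ ℕ | n.degree ≤ k} ≃
      (Finset.range (k + 1)).sigma (Finset.HasAntidiagonal.antidiagonal (A := ℕ)) :=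
    { toFun := fun n => ⟨⟨n.1 0 + n.1 1, (n.1 0, n.1 1)⟩, by
        have := n.2
        simp only [Set.mem_ofPred_eq, Finsupp.degree_eq_sum, Fin.sum_univ_two] at this
        simp; omega⟩
      invFun := fun x => ⟨Finsupp.equivFunOnFinite.symm ![x.1.2.1, x.1.2.2], by
        have := x.2
        simp only [Finset.mem_sigma, Finset.mem_range, Finset.HasAntidiagonal.mem_antidiagonal] at this
        simp only [Set.mem_ofPred_eq, Finsupp.degree_eq_sum, Fin.sum_univ_two]
        simp; omega⟩
      left_inv := fun n => by
        ext i; fin_cases i <;> simp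
      right_inv := fun x => by
        obtain ⟨⟨i, a, b⟩, h⟩ := x
        simp only [Finset.mem_sigma, Finset.mem_range, Finset.HasAntidiagonal.mem_antidiagonal] at h
        obtain ⟨h1, rfl⟩ := h
        simp }
  rw [Nat.card_congr e, Nat.card_eq_fintype_card, Fintype.card_coe, Finset.card_sigma]
  simp only [Finset.Nat.card_antidiagonal]
  clear e
  induction k with
  | zero => simp
  | succ k ih => rw [Finset.sum_range_succ, mul_add, ih]; ring

theorem two_mul_finrank_restrictTotalDegree (k : ℕ) :
    2 * Module.finrank ℝ (restrictTotalDegree (Fin 2) ℝ k) = (k + 1) * (k + 2) := by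
  rw [← two_mul_card_degree_le]
  congr 1
  exact Module.finrank_eq_nat_card_basis (basisRestrictSupport ℝ _)

/-- A polynomial of degree at most the size of `S`, nonzero at one point and vanishing at
all other points of `S`. -/
theorem exists_separating_poly (S : Finset Plane) (p : Plane) :
    ∃ f : Poly2, f.totalDegree ≤ S.card ∧ eval p f ≠ 0 ∧ ∀ q ∈ S, q ≠ p → eval q f = 0 := by
  classical
  have h : ∀ q : Plane, ∃ f : Poly2, f.totalDegree ≤ 1 ∧ eval p f ≠ 0 ∧ (q ≠ p → eval q f = 0) := by
    intro q
    by_cases hq : q = p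
    · exact ⟨1, by simp, by simp, fun h => absurd hq h⟩
    · obtain ⟨i, hi⟩ := Function.ne_iff.mp hq
      refine ⟨X i - C (q i), ?_, ?_, ?_⟩
      · refine (totalDegree_sub _ _).trans ?_
        simp
      · simpa [sub_eq_zero] using fun h => hi h.symm
      · simp
  choose F h1 h2 h3 using h
  refine ⟨∏ q ∈ S, F q, ?_, ?_, ?_⟩
  · refine (totalDegree_finsetProd _ _).trans ?_
    simpa using Finset.sum_le_sum fun q (_ : q ∈ S) => h1 q
  · rw [map_prod]; exact Finset.prod_ne_zero_iff.mpr fun q _ => h2 q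
  · intro q hq hqp
    rw [map_prod]; exact Finset.prod_eq_zero hq (h3 q hqp)

/-- Evaluation at the points of `S`, on polynomials of degree at most `D`. -/
def evalOn (S : Finset Plane) (D : ℕ) : restrictTotalDegree (Fin 2) ℝ D →ₗ[ℝ] (S → ℝ) :=
  (LinearMap.pi fun p : S => (aeval (p : Plane)).toLinearMap) ∘ₗ Submodule.subtype _

theorem evalOn_apply (S : Finset Plane) (D : ℕ) (f : restrictTotalDegree (Fin 2) ℝ D) (p : S) :
    evalOn S D f p = eval (p : Plane) (f : Poly2) := by
  simp [evalOn]

theorem evalOn_surjective (S : Finset Plane) (D : ℕ) (hD : S.card ≤ D) :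
    Function.Surjective (evalOn S D) := by
  classical
  rw [← LinearMap.range_eq_top, eq_top_iff, ← (Pi.basisFun ℝ S).span_eq, Submodule.span_le]
  rintro _ ⟨p, rfl⟩
  obtain ⟨f, h1, h2, h3⟩ := exists_separating_poly S p
  have hf : f ∈ restrictTotalDegree (Fin 2) ℝ D :=
    (mem_restrictTotalDegree _ _ _).mpr (h1.trans hD)
  refine ⟨(eval (p : Plane) f)⁻¹ • ⟨f, hf⟩, ?_⟩
  ext q
  rw [map_smul, Pi.smul_apply, evalOn_apply, Pi.basisFun_apply]
  by_cases hq : q = p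
  · subst hq; simp [h2]
  · simp [hq, h3 q q.2 (fun h => hq (Subtype.ext h))]

/-- Multiplication by a polynomial, as a map between spaces of polynomials of bounded
degree. -/
def mulRestrict (f : Poly2) (k D : ℕ) (h : f.totalDegree + k ≤ D) :
    restrictTotalDegree (Fin 2) ℝ k →ₗ[ℝ] restrictTotalDegree (Fin 2) ℝ D :=
  (LinearMap.mulLeft ℝ f).restrict fun g hg => by
    rw [mem_restrictTotalDegree] at hg ⊢
    exact (totalDegree_mul _ _).trans (by omega)

/-- Two coprime polynomials have at most as many common zeros as the product of their degrees. -/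
theorem card_le_totalDegree_mul_totalDegree {f g : Poly2} (hg : g ≠ 0)
    (hfg : IsRelPrime f g) (S : Finset Plane) (hS : ∀ p ∈ S, eval p f = 0 ∧ eval p g = 0) :
    S.card ≤ f.totalDegree * g.totalDegree := by
  set m := f.totalDegree with hm
  set n := g.totalDegree with hn
  set k := S.card with hk
  -- Koszul complex in bounded degree: `Φ (u, v) = f u + g v` and `Ψ w = (g w, -f w)`. Coprimality
  -- gives `ker Φ ≤ range Ψ`, so the rank of `Φ` is bounded below. Its range vanishes on `S`, while
  -- evaluation on `S` is onto because the degree is at least `S.card`. The dimension count leaves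
  -- exactly `m * n`.
  let Φ := LinearMap.coprod (mulRestrict f (k + n) (k + n + m) (by omega))
    (mulRestrict g (k + m) (k + n + m) (by omega))
  let Ψ := LinearMap.prod (mulRestrict g k (k + n) (by omega))
    (-mulRestrict f k (k + m) (by omega))
  have hker : LinearMap.ker Φ ≤ LinearMap.range Ψ := by
    rintro ⟨u, v⟩ huv
    have h : f * u + g * v = 0 := congrArg Subtype.val (LinearMap.mem_ker.mp huv)
    have hdvd : g ∣ f * (u : Poly2) := ⟨-v, by linear_combination h⟩
    obtain ⟨w, hw⟩ := hfg.symm.dvd_of_dvd_mul_left hdvd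
    have hv : (v : Poly2) = -(f * w) := by
      apply mul_left_cancel₀ hg
      rw [hw] at h
      linear_combination h
    have hwk : w ∈ restrictTotalDegree (Fin 2) ℝ k := by
      rw [mem_restrictTotalDegree]
      rcases eq_or_ne w 0 with rfl | hw0
      · simp
      have := (mem_restrictTotalDegree _ _ _).mp u.2
      rw [hw, totalDegree_mul_of_isDomain hg hw0] at this
      omega
    refine ⟨⟨w, hwk⟩, Prod.ext (Subtype.ext hw.symm) (Subtype.ext hv.symm)⟩
  have hrange : LinearMap.range Φ ≤ LinearMap.ker (evalOn S (k + n + m)) := by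
    rintro _ ⟨⟨u, v⟩, rfl⟩
    rw [LinearMap.mem_ker]
    ext p
    rw [evalOn_apply]
    have : ((Φ (u, v) : restrictTotalDegree (Fin 2) ℝ (k + n + m)) : Poly2) = f * u + g * v := rfl
    rw [this]
    simp [hS p p.2]
  have h1 := LinearMap.finrank_range_add_finrank_ker (evalOn S (k + n + m))
  have h2 := LinearMap.finrank_range_add_finrank_ker Φ
  have h3 := (Submodule.finrank_mono hker).trans (LinearMap.finrank_range_le Ψ)
  have h4 := Submodule.finrank_mono hrange
  rw [LinearMap.range_eq_top.mpr (evalOn_surjective S _ (by omega)), finrank_top,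
    Module.finrank_fintype_fun_eq_card, Fintype.card_coe] at h1
  rw [Module.finrank_prod] at h2
  have d1 := two_mul_finrank_restrictTotalDegree k
  have d2 := two_mul_finrank_restrictTotalDegree (k + n)
  have d3 := two_mul_finrank_restrictTotalDegree (k + m)
  have d4 := two_mul_finrank_restrictTotalDegree (k + n + m)
  nlinarith

/-! ### Restriction to axis-parallel lines -/

/-- The restriction of `f` to the vertical line `x = a`. -/
def vert (a : ℝ) (f : Poly2) : Polynomial ℝ := aeval ![Polynomial.C a, Polynomial.X] f

/-- The restriction of `f` to the horizontal line `y = b`. -/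
def horiz (b : ℝ) (f : Poly2) : Polynomial ℝ := aeval ![Polynomial.X, Polynomial.C b] f

theorem eval_vert (a y : ℝ) (f : Poly2) : (vert a f).eval y = eval ![a, y] f := by
  induction f using MvPolynomial.induction_on with
  | C c => simp [vert]
  | add p q hp hq => simpa [vert] using congrArg₂ (· + ·) hp hq
  | mul_X p i hp =>
    simp only [vert, map_mul, Polynomial.eval_mul, aeval_X, eval_X] at hp ⊢
    rw [hp]; fin_cases i <;> simp

theorem eval_horiz (x b : ℝ) (f : Poly2) : (horiz b f).eval x = eval ![x, b] f := by
  induction f using MvPolynomial.induction_on with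
  | C c => simp [horiz]
  | add p q hp hq => simpa [horiz] using congrArg₂ (· + ·) hp hq
  | mul_X p i hp =>
    simp only [horiz, map_mul, Polynomial.eval_mul, aeval_X, eval_X] at hp ⊢
    rw [hp]; fin_cases i <;> simp

theorem derivative_vert (a : ℝ) (f : Poly2) :
    Polynomial.derivative (vert a f) = vert a (pderiv 1 f) := by
  induction f using MvPolynomial.induction_on with
  | C c => simp [vert]
  | add p q hp hq => simpa [vert] using congrArg₂ (· + ·) hp hq
  | mul_X p i hp =>
    simp only [vert] at hp ⊢
    rw [pderiv_mul]
    simp only [map_mul, map_add, aeval_X, Polynomial.derivative_mul, hp]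
    congr 2
    fin_cases i <;> simp [pderiv_X]

theorem natDegree_vert_le (a : ℝ) (f : Poly2) : (vert a f).natDegree ≤ f.totalDegree := by
  have := aeval_natDegree_le f le_rfl (![Polynomial.C a, Polynomial.X] : Fin 2 → Polynomial ℝ)
    (n := 1) (fun i => by fin_cases i <;> simp)
  simpa [vert] using this

theorem natDegree_horiz_le (b : ℝ) (f : Poly2) : (horiz b f).natDegree ≤ f.totalDegree := by
  have := aeval_natDegree_le f le_rfl (![Polynomial.X, Polynomial.C b] : Fin 2 → Polynomial ℝ)
    (n := 1) (fun i => by fin_cases i <;> simp)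
  simpa [horiz] using this

/-- `f` vanishes identically on no axis-parallel line. -/
structure NoAxisLine (f : Poly2) : Prop where
  vert_ne : ∀ a, vert a f ≠ 0
  horiz_ne : ∀ b, horiz b f ≠ 0

theorem NoAxisLine.ne_zero {f : Poly2} (hf : NoAxisLine f) : f ≠ 0 := by
  rintro rfl
  exact hf.vert_ne 0 (by simp [vert])

/-- The zero set of a polynomial. -/
def zeros (f : Poly2) : Set Plane := {p | eval p f = 0}

theorem mem_zeros {f : Poly2} {p : Plane} : p ∈ zeros f ↔ eval p f = 0 := Iff.rfl

theorem zeros_mul (f g : Poly2) : zeros (f * g) = zeros f ∪ zeros g := by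
  ext p; simp [mem_zeros]

theorem vert_eq_zero_iff {a : ℝ} {f : Poly2} : vert a f = 0 ↔ ∀ y, ![a, y] ∈ zeros f := by
  constructor
  · intro h y; rw [mem_zeros, ← eval_vert, h, Polynomial.eval_zero]
  · intro h; exact Polynomial.funext fun y => by rw [eval_vert, Polynomial.eval_zero]; exact h y

theorem horiz_eq_zero_iff {b : ℝ} {f : Poly2} : horiz b f = 0 ↔ ∀ x, ![x, b] ∈ zeros f := by
  constructor
  · intro h y; rw [mem_zeros, ← eval_horiz, h, Polynomial.eval_zero]
  · intro h; exact Polynomial.funext fun y => by rw [eval_horiz, Polynomial.eval_zero]; exact h y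

theorem NoAxisLine.of_zeros_subset {f g : Poly2} (hf : NoAxisLine f) (h : zeros g ⊆ zeros f) :
    NoAxisLine g :=
  ⟨fun a ha => hf.vert_ne a (vert_eq_zero_iff.mpr fun y => h (vert_eq_zero_iff.mp ha y)),
   fun b hb => hf.horiz_ne b (horiz_eq_zero_iff.mpr fun x => h (horiz_eq_zero_iff.mp hb x))⟩

theorem totalDegree_pderiv_lt {f : Poly2} {i : Fin 2} (h : pderiv i f ≠ 0) :
    (pderiv i f).totalDegree < f.totalDegree := by
  have hpos : ∀ m ∈ (pderiv i f).support, m.degree + 1 ≤ f.totalDegree := by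
    intro m hm
    rw [mem_support_iff, coeff_pderiv] at hm
    have := le_totalDegree (p := f) (mem_support_iff.mpr (left_ne_zero_of_mul hm))
    have h2 : (m + Finsupp.single i 1).degree ≤ f.totalDegree := this
    simpa using h2
  obtain ⟨m, hm⟩ := support_nonempty.mpr h
  have h0 := hpos m hm
  refine Nat.lt_of_le_pred (by omega) ?_
  refine Finset.sup_le fun s hs => ?_
  have : s.degree + 1 ≤ f.totalDegree := hpos s hs
  have e : (s.sum fun _ e => e) = s.degree := rfl
  rw [e]; exact Nat.le_pred_of_lt this

/-! ### Reduced equations and critical points -/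

/-- The zero set of a polynomial vanishing on no axis-parallel line has an equation that is coprime
to its derivative. -/
theorem exists_reduced_poly {f : Poly2} (hf : NoAxisLine f) :
    ∃ g : Poly2, zeros g = zeros f ∧ g.totalDegree ≤ f.totalDegree ∧
      IsRelPrime g (pderiv 1 g) := by
  classical
  -- An equation `g` of least degree is chosen. An irreducible common factor `p` of `g = p * k` and
  -- its derivative would let `k` replace `g`, or would put a vertical line in the zero set.
  have hex : ∃ n, ∃ g : Poly2, zeros g = zeros f ∧ g.totalDegree = n := ⟨_, f, rfl, rfl⟩
  obtain ⟨g, hg, hgn⟩ := Nat.find_spec hex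
  have hmin : ∀ h : Poly2, zeros h = zeros f → g.totalDegree ≤ h.totalDegree := fun h hh => by
    rw [hgn]; exact Nat.find_min' hex ⟨h, hh, rfl⟩
  have hgl : NoAxisLine g := hf.of_zeros_subset hg.le
  have hg0 := hgl.ne_zero
  refine ⟨g, hg, hmin f rfl, ?_⟩
  intro w hwg hwd
  by_contra hw
  obtain ⟨p, hp, hpw⟩ := WfDvdMonoid.exists_irreducible_factor hw (ne_zero_of_dvd_ne_zero hg0 hwg)
  have hpg := hpw.trans hwg
  have hpd := hpw.trans hwd
  obtain ⟨k, rfl⟩ := hpg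
  have hp0 := hp.ne_zero
  have hk0 : k ≠ 0 := right_ne_zero_of_mul hg0
  have hpdeg : 0 < p.totalDegree := by
    rw [Nat.pos_iff_ne_zero]
    intro h
    rw [totalDegree_eq_zero_iff_eq_C] at h
    apply hp.not_isUnit
    rw [h]
    refine (IsUnit.mk0 _ fun h0 => hp0 ?_).map C
    rw [h, h0, C_0]
  have hkf : zeros k ≠ zeros f := fun h => by
    have := hmin k h
    rw [totalDegree_mul_of_isDomain hp0 hk0] at this
    omega
  have hprime : Prime p := hp.prime
  rw [pderiv_mul] at hpd
  have hpd' : p ∣ pderiv 1 p * k := (dvd_add_left (Dvd.intro _ rfl)).mp hpd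
  rcases hprime.dvd_or_dvd hpd' with h | h
  -- Comparing degrees, `p` is a polynomial in `x` alone. Without real zeros it could be dropped
  -- from `g`; with one, `g` vanishes on a whole vertical line.
  · have hd0 : pderiv 1 p = 0 := by
      by_contra hne
      have h1 := totalDegree_pderiv_lt hne
      obtain ⟨q, hq⟩ := h
      rw [hq] at hne h1
      rw [totalDegree_mul_of_isDomain hp0 (right_ne_zero_of_mul hne)] at h1
      omega
    have hz : ∃ z, z ∈ zeros p := by
      by_contra hno
      push Not at hno
      apply hkf
      rw [← hg, zeros_mul]
      ext z; simp [hno z]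
    obtain ⟨z, hz⟩ := hz
    apply hgl.vert_ne (z 0)
    rw [vert_eq_zero_iff]
    intro y
    rw [zeros_mul]
    left
    have hder := derivative_vert (z 0) p
    rw [hd0] at hder
    have hC := Polynomial.eq_C_of_derivative_eq_zero (p := vert (z 0) p)
      (hder.trans (by simp [vert]))
    have hzz : z = ![z 0, z 1] := by ext i; fin_cases i <;> rfl
    rw [mem_zeros, ← eval_vert, hC, Polynomial.eval_C]
    rw [hzz, mem_zeros, ← eval_vert, hC, Polynomial.eval_C] at hz
    exact hz
  · apply hkf
    rw [← hg, zeros_mul]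
    obtain ⟨q, rfl⟩ := h
    rw [zeros_mul, ← Set.union_assoc, Set.union_self]

/-! ### Critical points of curve pieces trapped in a box. -/

theorem continuous_eval_pair (f : Poly2) : Continuous fun z : ℝ × ℝ => eval ![z.1, z.2] f := by
  refine f.continuous_eval.comp (continuous_pi fun i => ?_)
  fin_cases i
  · exact continuous_fst
  · exact continuous_snd

theorem continuous_eval_left (f : Poly2) (b : ℝ) : Continuous fun t : ℝ => eval ![t, b] f := by
  simp_rw [← eval_horiz]; exact (horiz b f).continuous

theorem continuous_eval_right (f : Poly2) (a : ℝ) : Continuous fun t : ℝ => eval ![a, t] f := by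
  simp_rw [← eval_vert]; exact (vert a f).continuous

theorem exists_sign_change {f : Poly2} {x y a b : ℝ} (h0 : eval ![x, y] f = 0)
    (h1 : 0 < eval ![x, y] (pderiv 1 f)) (ha : a < y) (hb : y < b) :
    ∃ u v, a < u ∧ u < v ∧ v < b ∧ eval ![x, u] f < 0 ∧ 0 < eval ![x, v] f := by
  have hd : 0 < deriv (fun t => (vert x f).eval t) y := by
    rw [Polynomial.deriv, derivative_vert, eval_vert]; exact h1
  have hs := eventually_nhdsWithin_sign_eq_of_deriv_pos hd (by simpa [eval_vert] using h0)
  obtain ⟨l, ⟨hly, hl⟩⟩ := (((hs.filter_mono nhdsWithin_le_nhds).and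
    (Ioo_mem_nhdsLT ha)) : ∀ᶠ t in nhdsWithin y (Set.Iio y), _).exists
  obtain ⟨u, ⟨huy, hu⟩⟩ := (((hs.filter_mono nhdsWithin_le_nhds).and
    (Ioo_mem_nhdsGT hb)) : ∀ᶠ t in nhdsWithin y (Set.Ioi y), _).exists
  refine ⟨l, u, hl.1, hl.2.trans hu.1, hu.2, ?_, ?_⟩
  · rw [sign_neg (sub_neg.mpr hl.2), sign_eq_neg_one_iff, eval_vert] at hly
    exact hly
  · rw [sign_pos (sub_pos.mpr hu.1), sign_eq_one_iff, eval_vert] at huy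
    exact huy

/-- A zero in an open box at which `∂f/∂y > 0` is not the rightmost one. -/
theorem exists_zero_right {f : Poly2} {x y x₁ a b : ℝ} (h0 : eval ![x, y] f = 0)
    (h1 : 0 < eval ![x, y] (pderiv 1 f)) (hx : x < x₁) (ha : a < y) (hb : y < b) :
    ∃ x₂ y₂, x < x₂ ∧ x₂ < x₁ ∧ a < y₂ ∧ y₂ < b ∧ eval ![x₂, y₂] f = 0 := by
  obtain ⟨u, v, hau, huv, hvb, hu, hv⟩ := exists_sign_change h0 h1 ha hb
  have cu := continuous_eval_left f u
  have cv := continuous_eval_left f v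
  -- The opposite signs at heights `u` and `v` persist slightly to the right of `x`, where the
  -- intermediate value theorem yields a zero.
  have e₁ : ∀ᶠ t in nhdsWithin x (Set.Ioi x), eval ![t, u] f < 0 :=
    ((cu.tendsto x).eventually_lt_const hu).filter_mono nhdsWithin_le_nhds
  have e₂ : ∀ᶠ t in nhdsWithin x (Set.Ioi x), 0 < eval ![t, v] f :=
    ((cv.tendsto x).eventually_const_lt hv).filter_mono nhdsWithin_le_nhds
  have e₃ : ∀ᶠ t in nhdsWithin x (Set.Ioi x), t ∈ Set.Ioo x x₁ := Ioo_mem_nhdsGT hx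
  obtain ⟨t, htu, htv, ht⟩ := (e₁.and (e₂.and e₃)).exists
  have ct := continuous_eval_right f t
  obtain ⟨s, hs, hs0⟩ := intermediate_value_Icc huv.le ct.continuousOn
    (Set.mem_Icc.mpr ⟨htu.le, htv.le⟩)
  exact ⟨t, s, ht.1, ht.2, hau.trans_le hs.1, hs.2.trans_lt hvb, hs0⟩

/-- A box containing a zero of `f` but none on its boundary contains a common zero of `f` and
`∂f/∂y`. -/
theorem exists_critical_zero {f : Poly2} {x₀ x₁ y₀ y₁ x y : ℝ} (hx : x ∈ Set.Icc x₀ x₁)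
    (hy : y ∈ Set.Icc y₀ y₁) (hxy : eval ![x, y] f = 0)
    (hl : ∀ t ∈ Set.Icc y₀ y₁, eval ![x₀, t] f ≠ 0) (hr : ∀ t ∈ Set.Icc y₀ y₁, eval ![x₁, t] f ≠ 0)
    (hb : ∀ t ∈ Set.Icc x₀ x₁, eval ![t, y₀] f ≠ 0) (ht : ∀ t ∈ Set.Icc x₀ x₁, eval ![t, y₁] f ≠ 0) :
    ∃ u ∈ Set.Ioo x₀ x₁, ∃ v ∈ Set.Ioo y₀ y₁,
      eval ![u, v] f = 0 ∧ eval ![u, v] (pderiv 1 f) = 0 := by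
  have hc := continuous_eval_pair f
  have hK : IsCompact ((Set.Icc x₀ x₁ ×ˢ Set.Icc y₀ y₁) ∩ {z : ℝ × ℝ | eval ![z.1, z.2] f = 0}) :=
    (isCompact_Icc.prod isCompact_Icc).inter_right (isClosed_eq hc continuous_const)
  -- The rightmost zero in the closed box exists by compactness and is interior by the boundary
  -- hypotheses. If `∂f/∂y` did not vanish there, the curve would continue further to the right.
  obtain ⟨⟨u, v⟩, ⟨⟨hu, hv⟩, huv⟩, hmax⟩ :=
    hK.exists_isMaxOn ⟨(x, y), ⟨hx, hy⟩, hxy⟩ continuous_fst.continuousOn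
  simp only [Set.mem_ofPred_eq] at hu hv huv
  have hu' : u ∈ Set.Ioo x₀ x₁ :=
    ⟨lt_of_le_of_ne hu.1 (by rintro rfl; exact hl v hv huv),
      lt_of_le_of_ne hu.2 (by rintro rfl; exact hr v hv huv)⟩
  have hv' : v ∈ Set.Ioo y₀ y₁ :=
    ⟨lt_of_le_of_ne hv.1 (by rintro rfl; exact hb u hu huv),
      lt_of_le_of_ne hv.2 (by rintro rfl; exact ht u hu huv)⟩
  refine ⟨u, hu', v, hv', huv, ?_⟩
  by_contra hne
  obtain ⟨x₂, y₂, h1, h2, h3, h4, h5⟩ : ∃ x₂ y₂, u < x₂ ∧ x₂ < x₁ ∧ y₀ < y₂ ∧ y₂ < y₁ ∧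
      eval ![x₂, y₂] f = 0 := by
    rcases lt_or_gt_of_ne hne with h | h
    · obtain ⟨x₂, y₂, h1, h2, h3, h4, h5⟩ := exists_zero_right (f := -f) (by simpa using huv)
        (by simpa using h) hu'.2 hv'.1 hv'.2
      exact ⟨x₂, y₂, h1, h2, h3, h4, by simpa using h5⟩
    · exact exists_zero_right huv h hu'.2 hv'.1 hv'.2
  have := hmax (a := (x₂, y₂)) ⟨⟨⟨(hu'.1.trans h1).le, h2.le⟩, ⟨h3.le, h4.le⟩⟩, h5⟩
  exact absurd h1 (not_lt.mpr this)

/-! ### Counting the cells met by a curve -/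

theorem exists_partition (A : Finset ℝ) (k r : ℕ) (h : A.card ≤ r * k) :
    ∃ X : ℕ → ℝ, Monotone X ∧ (∀ a ∈ A, X 0 ≤ a ∧ a < X r) ∧
      ∀ i, (A.filter fun a => a ∈ Set.Ico (X i) (X (i + 1))).card ≤ k := by
  classical
  rcases A.eq_empty_or_nonempty with rfl | hA
  · exact ⟨fun _ => 0, monotone_const, by simp, by simp⟩
  let e := A.orderEmbOfFin rfl
  have hlt : ∀ j, e j < A.max' hA + 1 := fun j =>
    (A.le_max' _ (A.orderEmbOfFin_mem rfl j)).trans_lt (lt_add_one _)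
  have hsurj : ∀ a ∈ A, ∃ j, e j = a := fun a ha => by
    have : a ∈ Set.range e := by rw [A.range_orderEmbOfFin rfl]; exact ha
    exact this
  -- The cuts are every `k`-th element of the sorted set; past its end they stay at a value above
  -- the maximum, so that half-open blocks cover everything.
  let X : ℕ → ℝ := fun i => if h : i * k < A.card then e ⟨i * k, h⟩ else A.max' hA + 1
  have hX : ∀ i (h : i * k < A.card), X i = e ⟨i * k, h⟩ := fun i h => dif_pos h
  have hX' : ∀ i (_ : ¬ i * k < A.card), X i = A.max' hA + 1 := fun i h => dif_neg h
  have hle : ∀ i j, X i ≤ e j ↔ i * k ≤ j := by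
    intro i j
    by_cases h : i * k < A.card
    · rw [hX i h, e.le_iff_le]; rfl
    · rw [hX' i h]
      have := j.2
      exact ⟨fun h' => absurd (hlt j) (not_lt.mpr h'), fun h' => by omega⟩
  refine ⟨X, ?_, ?_, ?_⟩
  · intro i j hij
    by_cases h : j * k < A.card
    · rw [hX j h, hle]; exact Nat.mul_le_mul_right k hij
    · rw [hX' j h]
      by_cases h2 : i * k < A.card
      · rw [hX i h2]; exact (hlt _).le
      · rw [hX' i h2]
  · intro a ha
    obtain ⟨j, rfl⟩ := hsurj a ha
    refine ⟨(hle 0 j).mpr (by simp), ?_⟩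
    rw [hX' r (not_lt.mpr h)]; exact hlt j
  · intro i
    have : (A.filter fun a => a ∈ Set.Ico (X i) (X (i + 1))) ⊆
        (Finset.univ.filter fun j : Fin A.card =>
          (j : ℕ) ∈ Finset.Ico (i * k) ((i + 1) * k)).image e := by
      intro a ha
      rw [Finset.mem_filter] at ha
      obtain ⟨ha, h1, h2⟩ := ha
      obtain ⟨j, rfl⟩ := hsurj a ha
      rw [← not_le, hle] at h2
      rw [hle] at h1
      refine Finset.mem_image_of_mem _ (Finset.mem_filter.mpr ⟨Finset.mem_univ _, ?_⟩)
      rw [Finset.mem_Ico]; exact ⟨h1, not_le.mp h2⟩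
    refine (Finset.card_le_card this).trans (Finset.card_image_le.trans ?_)
    have hc : (Finset.Ico (i * k) ((i + 1) * k)).card = k := by
      rw [Nat.card_Ico, Nat.succ_mul]; omega
    refine le_of_le_of_eq ?_ hc
    refine Finset.card_le_card_of_injOn (fun j => (j : ℕ)) ?_ Fin.val_injective.injOn
    intro j hj
    exact (Finset.mem_filter.mp hj).2

theorem exists_mem_Ico_succ {X : ℕ → ℝ} {r : ℕ} {a : ℝ} (h0 : X 0 ≤ a) (hr : a < X r) :
    ∃ i < r, a ∈ Set.Ico (X i) (X (i + 1)) := by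
  induction r with
  | zero => exact absurd hr (not_lt.mpr h0)
  | succ r ih =>
    rcases lt_or_ge a (X r) with h | h
    · obtain ⟨i, hi, hia⟩ := ih h
      exact ⟨i, by omega, hia⟩
    · exact ⟨r, by omega, h, hr⟩

/-- Sending a box to its column and a chosen root in it is injective, since disjointness of the `J
j` recovers the row. It is applied with `R i` the zeros on the `i`-th cutting line. -/
theorem card_le_of_columns {T : Finset (ℕ × ℕ)} {r d : ℕ} {R : ℕ → Finset ℝ} {J : ℕ → Set ℝ}
    (hT : ∀ c ∈ T, c.1 < r) (hR : ∀ i, (R i).card ≤ d)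
    (hJ : Pairwise (Function.onFun Disjoint J)) (h : ∀ c ∈ T, ∃ y ∈ R c.1, y ∈ J c.2) :
    T.card ≤ r * d := by
  classical
  choose! y hyR hyJ using h
  have h1 : T.card ≤ ((Finset.range r).sigma R).card := by
    refine Finset.card_le_card_of_injOn (fun c => ⟨c.1, y c⟩) ?_ ?_
    · intro c hc
      exact Finset.mem_sigma.mpr ⟨Finset.mem_range.mpr (hT c hc), hyR c hc⟩
    · intro c hc c' hc' hcc
      obtain ⟨h1, h2⟩ := Sigma.mk.inj hcc
      refine Prod.ext h1 ?_
      by_contra hne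
      refine Set.disjoint_left.mp (hJ hne) (hyJ c hc) ?_
      rw [eq_of_heq h2]; exact hyJ c' hc'
  refine h1.trans ?_
  rw [Finset.card_sigma]
  simpa using Finset.sum_le_sum fun i (_ : i ∈ Finset.range r) => hR i

theorem card_le_of_rows {T : Finset (ℕ × ℕ)} {r d : ℕ} {R : ℕ → Finset ℝ} {J : ℕ → Set ℝ}
    (hT : ∀ c ∈ T, c.2 < r) (hR : ∀ i, (R i).card ≤ d)
    (hJ : Pairwise (Function.onFun Disjoint J)) (h : ∀ c ∈ T, ∃ x ∈ R c.2, x ∈ J c.1) :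
    T.card ≤ r * d := by
  classical
  rw [← Finset.card_image_of_injective T Prod.swap_injective]
  refine card_le_of_columns (R := R) (J := J) ?_ hR hJ ?_
  · intro c hc
    obtain ⟨c', hc', rfl⟩ := Finset.mem_image.mp hc
    exact hT c' hc'
  · intro c hc
    obtain ⟨c', hc', rfl⟩ := Finset.mem_image.mp hc
    exact h c' hc'

theorem card_roots_vert_le (a : ℝ) (f : Poly2) : (vert a f).roots.toFinset.card ≤ f.totalDegree :=
  (Multiset.toFinset_card_le _).trans ((Polynomial.card_roots' _).trans (natDegree_vert_le a f))

theorem card_roots_horiz_le (b : ℝ) (f : Poly2) :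
    (horiz b f).roots.toFinset.card ≤ f.totalDegree :=
  (Multiset.toFinset_card_le _).trans ((Polynomial.card_roots' _).trans (natDegree_horiz_le b f))

theorem NoAxisLine.mem_roots_vert {f : Poly2} (hf : NoAxisLine f) {a y : ℝ}
    (h : eval ![a, y] f = 0) : y ∈ (vert a f).roots.toFinset := by
  rw [Multiset.mem_toFinset, Polynomial.mem_roots (hf.vert_ne a), Polynomial.IsRoot, eval_vert, h]

theorem NoAxisLine.mem_roots_horiz {f : Poly2} (hf : NoAxisLine f) {x b : ℝ}
    (h : eval ![x, b] f = 0) : x ∈ (horiz b f).roots.toFinset := by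
  rw [Multiset.mem_toFinset, Polynomial.mem_roots (hf.horiz_ne b), Polynomial.IsRoot, eval_horiz, h]

theorem card_le_of_critical_points {f : Poly2} (hrel : IsRelPrime f (pderiv 1 f))
    {X Y : ℕ → ℝ} (hX : Monotone X) (hY : Monotone Y) {T : Finset (ℕ × ℕ)}
    (h : ∀ c ∈ T, ∃ u ∈ Set.Ioo (X c.1) (X (c.1 + 1)), ∃ v ∈ Set.Ioo (Y c.2) (Y (c.2 + 1)),
      eval ![u, v] f = 0 ∧ eval ![u, v] (pderiv 1 f) = 0) :
    T.card ≤ f.totalDegree ^ 2 := by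
  classical
  choose! u hu v hv h0 h1 using h
  have hinj : Set.InjOn (fun c => (![u c, v c] : Plane)) T := by
    intro c hc c' hc' hcc
    have e0 : u c = u c' := congrFun hcc 0
    have e1 : v c = v c' := congrFun hcc 1
    refine Prod.ext ?_ ?_
    · by_contra hne
      refine Set.disjoint_left.mp (hX.pairwise_disjoint_on_Ioo_succ hne) (hu c hc) ?_
      rw [e0]; exact hu c' hc'
    · by_contra hne
      refine Set.disjoint_left.mp (hY.pairwise_disjoint_on_Ioo_succ hne) (hv c hc) ?_
      rw [e1]; exact hv c' hc'
  rw [← Finset.card_image_of_injOn hinj]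
  have hz : ∀ p ∈ T.image fun c => (![u c, v c] : Plane),
      eval p f = 0 ∧ eval p (pderiv 1 f) = 0 := by
    intro p hp
    obtain ⟨c, hc, rfl⟩ := Finset.mem_image.mp hp
    exact ⟨h0 c hc, h1 c hc⟩
  -- If the derivative is zero, coprimality makes `f` a unit, which has no zeros; Bézout covers the
  -- other case.
  by_cases hd : pderiv 1 f = 0
  · rw [hd, isRelPrime_zero_right] at hrel
    rw [Finset.card_eq_zero.mpr]
    · exact Nat.zero_le _
    · rw [Finset.eq_empty_iff_forall_notMem]
      intro p hp
      exact (hrel.map (eval p)).ne_zero (hz p hp).1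
  · refine (card_le_totalDegree_mul_totalDegree hd hrel _ hz).trans ?_
    rw [sq]
    exact Nat.mul_le_mul_left _ (totalDegree_pderiv_lt hd).le

theorem card_cells_le {f : Poly2} (hf : NoAxisLine f) {d r : ℕ} (hd : f.totalDegree ≤ d)
    {X Y : ℕ → ℝ} (hX : Monotone X) (hY : Monotone Y) {T : Finset (ℕ × ℕ)}
    (hTr : ∀ c ∈ T, c.1 < r ∧ c.2 < r)
    (hT : ∀ c ∈ T, ∃ x ∈ Set.Ico (X c.1) (X (c.1 + 1)), ∃ y ∈ Set.Ico (Y c.2) (Y (c.2 + 1)),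
      ![x, y] ∈ zeros f) :
    T.card ≤ 4 * (r * d) + d ^ 2 := by
  classical
  obtain ⟨g, hgz, hgd, hrel⟩ := exists_reduced_poly hf
  have hg : NoAxisLine g := hf.of_zeros_subset hgz.le
  rw [← hgz] at hT
  have hdeg := hgd.trans hd
  -- The four sides are half-open, so that the sides along one line are disjoint. Each contains a
  -- different corner, so together they still form the whole boundary.
  let T₁ := T.filter fun c => ∃ y ∈ Set.Ico (Y c.2) (Y (c.2 + 1)), eval ![X c.1, y] g = 0
  let T₂ := T.filter fun c => ∃ y ∈ Set.Ioc (Y c.2) (Y (c.2 + 1)), eval ![X (c.1 + 1), y] g = 0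
  let T₃ := T.filter fun c => ∃ x ∈ Set.Ioc (X c.1) (X (c.1 + 1)), eval ![x, Y c.2] g = 0
  let T₄ := T.filter fun c => ∃ x ∈ Set.Ico (X c.1) (X (c.1 + 1)), eval ![x, Y (c.2 + 1)] g = 0
  let T₅ := T.filter fun c => ∃ u ∈ Set.Ioo (X c.1) (X (c.1 + 1)),
    ∃ v ∈ Set.Ioo (Y c.2) (Y (c.2 + 1)), eval ![u, v] g = 0 ∧ eval ![u, v] (pderiv 1 g) = 0
  have hcover : T ⊆ T₁ ∪ T₂ ∪ T₃ ∪ T₄ ∪ T₅ := by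
    intro c hc
    by_contra hno
    simp only [T₁, T₂, T₃, T₄, T₅, Finset.mem_union, Finset.mem_filter, hc, true_and, not_or] at hno
    obtain ⟨⟨⟨⟨n1, n2⟩, n3⟩, n4⟩, n5⟩ := hno
    push Not at n1 n2 n3 n4
    obtain ⟨x, hx, y, hy, hxy⟩ := hT c hc
    have hXlt := hx.1.trans_lt hx.2
    have hYlt := hy.1.trans_lt hy.2
    refine n5 (exists_critical_zero ⟨hx.1, hx.2.le⟩ ⟨hy.1, hy.2.le⟩ hxy ?_ ?_ ?_ ?_)
    · intro t ht
      rcases ht.2.lt_or_eq with h | rfl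
      · exact n1 t ⟨ht.1, h⟩
      · exact n4 _ ⟨le_rfl, hXlt⟩
    · intro t ht
      rcases ht.1.lt_or_eq with h | rfl
      · exact n2 t ⟨h, ht.2⟩
      · exact n3 _ ⟨hXlt, le_rfl⟩
    · intro t ht
      rcases ht.1.lt_or_eq with h | rfl
      · exact n3 t ⟨h, ht.2⟩
      · exact n1 _ ⟨le_rfl, hYlt⟩
    · intro t ht
      rcases ht.2.lt_or_eq with h | rfl
      · exact n4 t ⟨ht.1, h⟩
      · exact n2 _ ⟨hYlt, le_rfl⟩
  have c1 : T₁.card ≤ r * d := by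
    refine card_le_of_columns (R := fun i => (vert (X i) g).roots.toFinset)
      (fun c hc => (hTr c (Finset.mem_filter.mp hc).1).1)
      (fun i => (card_roots_vert_le _ g).trans hdeg) hY.pairwise_disjoint_on_Ico_succ ?_
    intro c hc
    obtain ⟨-, y, hy, h⟩ := Finset.mem_filter.mp hc
    exact ⟨y, hg.mem_roots_vert h, hy⟩
  have c2 : T₂.card ≤ r * d := by
    refine card_le_of_columns (R := fun i => (vert (X (i + 1)) g).roots.toFinset)
      (fun c hc => (hTr c (Finset.mem_filter.mp hc).1).1)
      (fun i => (card_roots_vert_le _ g).trans hdeg) hY.pairwise_disjoint_on_Ioc_succ ?_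
    intro c hc
    obtain ⟨-, y, hy, h⟩ := Finset.mem_filter.mp hc
    exact ⟨y, hg.mem_roots_vert h, hy⟩
  have c3 : T₃.card ≤ r * d := by
    refine card_le_of_rows (R := fun i => (horiz (Y i) g).roots.toFinset)
      (fun c hc => (hTr c (Finset.mem_filter.mp hc).1).2)
      (fun i => (card_roots_horiz_le _ g).trans hdeg) hX.pairwise_disjoint_on_Ioc_succ ?_
    intro c hc
    obtain ⟨-, x, hx, h⟩ := Finset.mem_filter.mp hc
    exact ⟨x, hg.mem_roots_horiz h, hx⟩
  have c4 : T₄.card ≤ r * d := by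
    refine card_le_of_rows (R := fun i => (horiz (Y (i + 1)) g).roots.toFinset)
      (fun c hc => (hTr c (Finset.mem_filter.mp hc).1).2)
      (fun i => (card_roots_horiz_le _ g).trans hdeg) hX.pairwise_disjoint_on_Ico_succ ?_
    intro c hc
    obtain ⟨-, x, hx, h⟩ := Finset.mem_filter.mp hc
    exact ⟨x, hg.mem_roots_horiz h, hx⟩
  have c5 : T₅.card ≤ d ^ 2 :=
    (card_le_of_critical_points hrel hX hY fun c hc => (Finset.mem_filter.mp hc).2).trans
      (Nat.pow_le_pow_left hdeg 2)
  have := Finset.card_le_card hcover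
  have u1 := Finset.card_union_le (T₁ ∪ T₂ ∪ T₃ ∪ T₄) T₅
  have u2 := Finset.card_union_le (T₁ ∪ T₂ ∪ T₃) T₄
  have u3 := Finset.card_union_le (T₁ ∪ T₂) T₃
  have u4 := Finset.card_union_le T₁ T₂
  omega

/-! ### Double counting -/

section Counting

open Classical

variable {γ δ : Type*} [DecidableEq δ] {C : Finset γ} {Z : γ → Set Plane} {P : Finset Plane} {M : ℕ}

theorem sum_card_pairs_le
    (hM : ∀ p ∈ P, ∀ q ∈ P, p ≠ q → (C.filter fun c => p ∈ Z c ∧ q ∈ Z c).card ≤ M)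
    (R : Plane → Plane → Prop) [DecidableRel R] :
    ∑ c ∈ C, ((P ×ˢ P).filter fun x => (x.1 ≠ x.2 ∧ R x.1 x.2) ∧ x.1 ∈ Z c ∧ x.2 ∈ Z c).card ≤
      M * ((P ×ˢ P).filter fun x => R x.1 x.2).card := by
  have h := Finset.sum_card_bipartiteAbove_eq_sum_card_bipartiteBelow (s := C)
    (t := (P ×ˢ P).filter fun x => x.1 ≠ x.2 ∧ R x.1 x.2)
    (fun c (x : Plane × Plane) => x.1 ∈ Z c ∧ x.2 ∈ Z c)
  simp only [Finset.bipartiteAbove, Finset.bipartiteBelow, Finset.filter_filter] at h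
  rw [h, mul_comm, ← smul_eq_mul]
  refine (Finset.sum_le_card_nsmul _ _ M ?_).trans ?_
  · intro x hx
    simp only [Finset.mem_filter, Finset.mem_product] at hx
    exact hM _ hx.1.1 _ hx.1.2 hx.2.1
  · refine nsmul_le_nsmul_left (Nat.zero_le _) (Finset.card_le_card ?_)
    exact Finset.monotone_filter_right _ fun x _ hx => hx.2

/-- One representative is picked in every cell met by `S`. Representatives are counted by the image,
and any other point is charged to its pair with the representative. -/
theorem card_le_card_image_add_card_pairs (S : Finset Plane) (κ : Plane → δ) :
    S.card ≤ (S.image κ).card +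
      ((S ×ˢ S).filter fun x => x.1 ≠ x.2 ∧ κ x.1 = κ x.2).card := by
  have h : ∀ t ∈ S.image κ, ∃ q ∈ S, κ q = t := fun t ht => Finset.mem_image.mp ht
  choose! ρ hρS hρ using h
  rw [← Finset.card_filter_add_card_filter_not (s := S) fun p => p = ρ (κ p)]
  refine add_le_add ?_ ?_
  · refine Finset.card_le_card_of_injOn κ ?_ ?_
    · intro p hp; exact Finset.mem_image_of_mem _ (Finset.mem_filter.mp hp).1
    · intro p hp q hq hpq
      rw [(Finset.mem_filter.mp hp).2, (Finset.mem_filter.mp hq).2, hpq]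
  · refine Finset.card_le_card_of_injOn (fun p => (p, ρ (κ p))) ?_ ?_
    · intro p hp
      obtain ⟨hp, hne⟩ := Finset.mem_filter.mp hp
      have hm := Finset.mem_image_of_mem κ hp
      simp only [Finset.coe_filter, Finset.mem_product, Set.mem_ofPred_eq]
      exact ⟨⟨hp, hρS _ hm⟩, hne, (hρ _ hm).symm⟩
    · intro p _ q _ hpq
      exact (Prod.mk.inj hpq).1

theorem sum_card_le_of_cells
    (hM : ∀ p ∈ P, ∀ q ∈ P, p ≠ q → (C.filter fun c => p ∈ Z c ∧ q ∈ Z c).card ≤ M)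
    (κ : Plane → δ) {v k : ℕ}
    (hv : ∀ c ∈ C, ((P.filter fun p => p ∈ Z c).image κ).card ≤ v)
    (hk : ∀ p ∈ P, (P.filter fun q => κ p = κ q).card ≤ k) :
    ∑ c ∈ C, (P.filter fun p => p ∈ Z c).card ≤ C.card * v + M * (P.card * k) := by
  have h1 : ∑ c ∈ C, (P.filter fun p => p ∈ Z c).card ≤ ∑ c ∈ C, (v +
      ((P ×ˢ P).filter fun x => (x.1 ≠ x.2 ∧ κ x.1 = κ x.2) ∧ x.1 ∈ Z c ∧ x.2 ∈ Z c).card) := by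
    refine Finset.sum_le_sum fun c hc => ?_
    refine (card_le_card_image_add_card_pairs _ κ).trans (add_le_add (hv c hc) ?_)
    refine Finset.card_le_card fun x hx => ?_
    simp only [Finset.mem_filter, Finset.mem_product] at hx ⊢
    tauto
  rw [Finset.sum_add_distrib, Finset.sum_const, smul_eq_mul] at h1
  refine h1.trans (add_le_add le_rfl ((sum_card_pairs_le hM
    fun p q => κ p = κ q).trans (Nat.mul_le_mul_left _ ?_)))
  rw [Finset.card_filter, Finset.sum_product]
  rw [← smul_eq_mul]
  refine Finset.sum_le_card_nsmul P _ k fun p hp => ?_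
  rw [← Finset.card_filter]
  exact hk p hp

/-- Cauchy–Schwarz over the curves. The square of the number of points on a curve counts ordered
pairs: the diagonal returns the incidences, and the off-diagonal pairs lie on at most `M` curves
each. -/
theorem sq_sum_card_le
    (hM : ∀ p ∈ P, ∀ q ∈ P, p ≠ q → (C.filter fun c => p ∈ Z c ∧ q ∈ Z c).card ≤ M) :
    (∑ c ∈ C, (P.filter fun p => p ∈ Z c).card) ^ 2 ≤
      C.card * (∑ c ∈ C, (P.filter fun p => p ∈ Z c).card + M * P.card ^ 2) := by
  refine sq_sum_le_card_mul_sum_sq.trans (Nat.mul_le_mul_left _ ?_)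
  have h := sum_card_pairs_le hM (fun _ _ => True)
  simp only [Finset.filter_true, Finset.card_product, ← sq] at h
  refine le_trans ?_ (add_le_add le_rfl h)
  rw [← Finset.sum_add_distrib]
  refine Finset.sum_le_sum fun c _ => ?_
  rw [sq, ← Finset.card_product,
    ← Finset.card_filter_add_card_filter_not (fun x : Plane × Plane => x.1 = x.2)]
  refine add_le_add ?_ (Finset.card_le_card fun x hx => ?_)
  · refine Finset.card_le_card_of_injOn Prod.fst ?_ ?_
    · intro x hx
      exact (Finset.mem_product.mp (Finset.mem_filter.mp hx).1).1
    · intro x hx y hy hxy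
      exact Prod.ext hxy ((Finset.mem_filter.mp hx).2.symm.trans
        (hxy.trans (Finset.mem_filter.mp hy).2))
  · simp only [Finset.mem_filter, Finset.mem_product] at hx ⊢
    tauto

/-! ### Cell bounds on Cartesian products. -/

theorem mem_grid {A B : Finset ℝ} {p : Plane} : p ∈ grid A B ↔ p 0 ∈ A ∧ p 1 ∈ B := by
  simp only [grid, Finset.mem_map_equiv, Equiv.symm_symm, Finset.mem_product]
  rfl

theorem card_grid (A B : Finset ℝ) : (grid A B).card = A.card * B.card := by
  rw [grid, Finset.card_map, Finset.card_product]

theorem eq_vec (p : Plane) : p = ![p 0, p 1] := by ext i; fin_cases i <;> rfl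

theorem exists_block_size {n r : ℕ} (hr : 1 ≤ r) (hrn : r ≤ n) :
    ∃ k, n ≤ r * k ∧ r * k ≤ 2 * n := by
  refine ⟨n / r + 1, ?_, ?_⟩
  · exact (Nat.lt_mul_div_succ n hr).le
  · have := Nat.mul_div_le n r
    rw [mul_add]; omega

/-- The cell bound with denominators cleared. Blocks of sizes `k`, `l` satisfy `r * k ≤ 2 * |A|` and
`r * l ≤ 2 * |B|`, whence the factor `4`. -/
theorem sum_card_grid_le {A B : Finset ℝ} {F : γ → Poly2} {d r : ℕ}
    (hF : ∀ c ∈ C, NoAxisLine (F c) ∧ (F c).totalDegree ≤ d)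
    (hM : ∀ p ∈ grid A B, ∀ q ∈ grid A B, p ≠ q →
      (C.filter fun c => p ∈ zeros (F c) ∧ q ∈ zeros (F c)).card ≤ M)
    (hr : 1 ≤ r) (hA : r ≤ A.card) (hB : r ≤ B.card) :
    r ^ 2 * ∑ c ∈ C, ((grid A B).filter fun p => p ∈ zeros (F c)).card ≤
      r ^ 2 * (C.card * (4 * (r * d) + d ^ 2)) + 4 * (M * (grid A B).card ^ 2) := by
  obtain ⟨k, hk1, hk2⟩ := exists_block_size hr hA
  obtain ⟨l, hl1, hl2⟩ := exists_block_size hr hB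
  obtain ⟨X, hX, hXA, hXc⟩ := exists_partition A k r hk1
  obtain ⟨Y, hY, hYB, hYc⟩ := exists_partition B l r hl1
  have hi : ∀ a ∈ A, ∃ i < r, a ∈ Set.Ico (X i) (X (i + 1)) := fun a ha =>
    exists_mem_Ico_succ (hXA a ha).1 (hXA a ha).2
  have hj : ∀ b ∈ B, ∃ i < r, b ∈ Set.Ico (Y i) (Y (i + 1)) := fun b hb =>
    exists_mem_Ico_succ (hYB b hb).1 (hYB b hb).2
  choose! ξ hξr hξ using hi
  choose! η hηr hη using hj
  have key := sum_card_le_of_cells (C := C) (Z := fun c => zeros (F c)) (P := grid A B) hM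
    (fun p => (ξ (p 0), η (p 1))) (v := 4 * (r * d) + d ^ 2) (k := k * l) ?_ ?_
  · calc _ ≤ r ^ 2 * (C.card * (4 * (r * d) + d ^ 2) + M * ((grid A B).card * (k * l))) :=
          Nat.mul_le_mul_left _ key
      _ = r ^ 2 * (C.card * (4 * (r * d) + d ^ 2)) +
          M * ((grid A B).card * ((r * k) * (r * l))) := by ring
      _ ≤ r ^ 2 * (C.card * (4 * (r * d) + d ^ 2)) +
          M * ((grid A B).card * ((2 * A.card) * (2 * B.card))) := by gcongr
      _ = _ := by rw [card_grid]; ring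
  · intro c hc
    refine card_cells_le (hF c hc).1 (hF c hc).2 hX hY ?_ ?_
    · intro t ht
      obtain ⟨p, hp, rfl⟩ := Finset.mem_image.mp ht
      have hp := mem_grid.mp (Finset.mem_filter.mp hp).1
      exact ⟨hξr _ hp.1, hηr _ hp.2⟩
    · intro t ht
      obtain ⟨p, hp, rfl⟩ := Finset.mem_image.mp ht
      have hpz := (Finset.mem_filter.mp hp).2
      have hp := mem_grid.mp (Finset.mem_filter.mp hp).1
      exact ⟨p 0, hξ _ hp.1, p 1, hη _ hp.2, by rwa [← eq_vec p]⟩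
  · intro p hp
    refine le_trans (Finset.card_le_card (t := grid
      (A.filter fun a => a ∈ Set.Ico (X (ξ (p 0))) (X (ξ (p 0) + 1)))
      (B.filter fun b => b ∈ Set.Ico (Y (η (p 1))) (Y (η (p 1) + 1)))) ?_) ?_
    · intro q hq
      obtain ⟨hq, hpq⟩ := Finset.mem_filter.mp hq
      obtain ⟨h1, h2⟩ := Prod.mk.inj hpq
      have hq := mem_grid.mp hq
      rw [mem_grid, Finset.mem_filter, Finset.mem_filter, h1, h2]
      exact ⟨⟨hq.1, hξ _ hq.1⟩, hq.2, hη _ hq.2⟩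
    · rw [card_grid]; exact Nat.mul_le_mul (hXc _) (hYc _)

/-- The trivial bound: a curve without vertical lines meets each column in at most `d` points. -/
theorem card_zeros_grid_le {A B : Finset ℝ} {f : Poly2} (hf : NoAxisLine f) {d : ℕ}
    (hd : f.totalDegree ≤ d) :
    ((grid A B).filter fun p => p ∈ zeros f).card ≤ A.card * d := by
  have h1 : ((grid A B).filter fun p => p ∈ zeros f).card ≤
      (A.sigma fun a => (vert a f).roots.toFinset).card := by
    refine Finset.card_le_card_of_injOn (fun p => ⟨p 0, p 1⟩) ?_ ?_
    · intro p hp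
      obtain ⟨hp, hz⟩ := Finset.mem_filter.mp hp
      rw [eq_vec p] at hz
      exact Finset.mem_sigma.mpr ⟨(mem_grid.mp hp).1, hf.mem_roots_vert hz⟩
    · intro p _ q _ hpq
      obtain ⟨h1, h2⟩ := Sigma.mk.inj hpq
      rw [eq_vec p, eq_vec q, h1, eq_of_heq h2]
  refine h1.trans ?_
  rw [Finset.card_sigma]
  simpa using Finset.sum_le_sum fun a (_ : a ∈ A) => (card_roots_vert_le a f).trans hd

end Counting

/-! ### Equations of curves -/

theorem zeroSet_singleton (f : Poly2) : zeroSet {f} = zeros f := by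
  ext p; simp [zeroSet, zeros]

theorem exists_zeros_eq_zeroSet (S : Finset Poly2) : ∃ f : Poly2, zeroSet S = zeros f := by
  refine ⟨∑ g ∈ S, g ^ 2, ?_⟩
  ext p
  rw [mem_zeros, map_sum, Finset.sum_eq_zero_iff_of_nonneg fun g _ => by
    rw [map_pow]; exact sq_nonneg _]
  simp [zeroSet]

theorem realDim_univ : realDim Set.univ = 2 := by
  have h : vanishingIdeal ℝ (Set.univ : Set Plane) = ⊥ := by
    rw [eq_bot_iff]
    intro f hf
    rw [mem_vanishingIdeal_iff] at hf
    refine (Submodule.mem_bot _).mpr (MvPolynomial.funext fun p => ?_)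
    simpa [coe_aeval_eq_eval] using hf p (Set.mem_univ p)
  rw [realDim, h, ringKrullDim_eq_of_ringEquiv (RingEquiv.quotientBot Poly2),
    MvPolynomial.ringKrullDim_of_isNoetherianRing]
  simp

theorem realDim_empty : realDim ∅ = ⊥ := by
  have h : vanishingIdeal ℝ (∅ : Set Plane) = ⊤ := by
    rw [eq_top_iff]
    intro f _
    rw [mem_vanishingIdeal_iff]
    exact fun p hp => absurd hp (Set.notMem_empty p)
  rw [realDim, h]
  have : Subsingleton (Poly2 ⧸ (⊤ : Ideal Poly2)) := Ideal.Quotient.subsingleton_iff.mpr rfl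
  exact ringKrullDim_eq_bot_of_subsingleton

/-- Dimension one excludes the plane (dimension `2`), so the equation is nonzero, and the empty set
(dimension `⊥`), so it is not constant. The latter forces `1 ≤ d` as soon as there is a curve. -/
theorem IsRealCurve.exists_poly {c : Set Plane} (hc : IsRealCurve c) :
    ∃ f : Poly2, f ≠ 0 ∧ c = zeros f ∧ f.totalDegree = curveDegree c ∧ 1 ≤ f.totalDegree := by
  obtain ⟨⟨S, hS⟩, hdim⟩ := hc
  have hne : {n | ∃ f : Poly2, c = zeroSet {f} ∧ f.totalDegree = n}.Nonempty := by
    obtain ⟨f, hf⟩ := exists_zeros_eq_zeroSet S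
    exact ⟨_, f, by rw [zeroSet_singleton, hS, hf], rfl⟩
  obtain ⟨f, hf, hfd⟩ := Nat.sInf_mem hne
  rw [zeroSet_singleton] at hf
  have h0 : f ≠ 0 := by
    rintro rfl
    have : c = Set.univ := by rw [hf]; ext p; simp [mem_zeros]
    rw [this, realDim_univ] at hdim
    exact absurd hdim (by decide)
  refine ⟨f, h0, hf, hfd, ?_⟩
  rw [Nat.one_le_iff_ne_zero]
  intro hdeg
  rw [totalDegree_eq_zero_iff_eq_C] at hdeg
  have : c = ∅ := by
    rw [hf, Set.eq_empty_iff_forall_notMem]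
    intro p hp
    rw [mem_zeros, hdeg, eval_C] at hp
    exact h0 (by rw [hdeg, hp, C_0])
  rw [this, realDim_empty] at hdim
  exact absurd hdim (by decide)

theorem noAxisLine_of_not_contains {f : Poly2} (h : ¬ ContainsAxisParallelLine (zeros f)) :
    NoAxisLine f := by
  rw [ContainsAxisParallelLine, not_or] at h
  refine ⟨fun a ha => h.2 ⟨a, fun p hp => ?_⟩, fun b hb => h.1 ⟨b, fun p hp => ?_⟩⟩
  · rw [eq_vec p, show p 0 = a from hp]; exact vert_eq_zero_iff.mp ha _
  · rw [eq_vec p, show p 1 = b from hp]; exact horiz_eq_zero_iff.mp hb _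

/-! ### Splitting off axis-parallel lines -/

/-- Modulo `X i - C a`, `f` equals the result of substituting `a` for `X i`, and that polynomial
vanishes at every point. -/
theorem X_sub_C_dvd_of_forall_zero {f : Poly2} {i : Fin 2} {a : ℝ}
    (h : ∀ p : Plane, p i = a → eval p f = 0) : X i - C a ∣ f := by
  have h1 : ∀ g : Poly2, X i - C a ∣ g - aeval (Function.update X i (C a)) g := by
    intro g
    induction g using MvPolynomial.induction_on with
    | C c => simp [algebraMap_eq]
    | add p q hp hq => rw [map_add, add_sub_add_comm]; exact dvd_add hp hq
    | mul_X p j hp =>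
      rw [map_mul, aeval_X]
      have : p * X j - aeval (Function.update X i (C a)) p * Function.update X i (C a) j =
          (p - aeval (Function.update X i (C a)) p) * X j +
          aeval (Function.update X i (C a)) p * (X j - Function.update X i (C a) j) := by ring
      rw [this]
      refine dvd_add (hp.mul_right _) (Dvd.dvd.mul_left ?_ _)
      rcases eq_or_ne j i with rfl | hj
      · simp
      · simp [Function.update_of_ne hj]
  have h2 : aeval (Function.update X i (C a)) f = (0 : Poly2) := by
    refine MvPolynomial.funext fun p => ?_
    have e : ∀ g : Poly2, eval p (aeval (Function.update X i (C a)) g) =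
        eval (Function.update p i a) g := by
      intro g
      induction g using MvPolynomial.induction_on with
      | C c => simp [algebraMap_eq]
      | add p q hp hq => simp only [map_add, hp, hq]
      | mul_X p j hp =>
        simp only [map_mul, hp, aeval_X, eval_X]
        rcases eq_or_ne j i with rfl | hj
        · simp
        · simp [Function.update_of_ne hj]
    rw [e, h _ (by simp), map_zero]
  have := h1 f
  rwa [h2, sub_zero] at this

theorem one_le_totalDegree_X_sub_C (i : Fin 2) (a : ℝ) :
    1 ≤ (X i - C a : Poly2).totalDegree := by
  rw [Nat.one_le_iff_ne_zero]
  intro h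
  have hC := totalDegree_eq_zero_iff_eq_C.mp h
  have h0 := congrArg (eval fun _ => a) hC
  have h1 := congrArg (eval fun _ => a + 1) hC
  rw [eval_C] at h0 h1
  rw [← h0] at h1
  simp at h1

theorem exists_split_lines (n : ℕ) : ∀ f : Poly2, f ≠ 0 → f.totalDegree ≤ n →
    ∃ (g : Poly2) (U V : Finset ℝ), NoAxisLine g ∧ g.totalDegree ≤ n ∧ U.card ≤ n ∧ V.card ≤ n ∧
      zeros f = zeros g ∪ ({p | p 0 ∈ U} ∪ {p | p 1 ∈ V}) := by
  classical
  induction n with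
  | zero =>
    intro f hf hd
    refine ⟨f, ∅, ∅, ?_, hd, by simp, by simp, by simp⟩
    have hC := totalDegree_eq_zero_iff_eq_C.mp (Nat.le_zero.mp hd)
    have h0 : coeff 0 f ≠ 0 := fun h => hf (by rw [hC, h, C_0])
    constructor
    · intro a ha; apply h0; have := vert_eq_zero_iff.mp ha 0; rwa [mem_zeros, hC, eval_C] at this
    · intro a ha; apply h0; have := horiz_eq_zero_iff.mp ha 0; rwa [mem_zeros, hC, eval_C] at this
  | succ n ih =>
    intro f hf hd
    -- Dividing out the equation of a contained line lowers the degree, so at most `n` lines are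
    -- removed.
    have step : ∀ (i : Fin 2) (a : ℝ), (∀ p : Plane, p i = a → eval p f = 0) →
        ∃ h : Poly2, h ≠ 0 ∧ h.totalDegree ≤ n ∧ zeros f = zeros h ∪ {p | p i = a} := by
      intro i a hz
      obtain ⟨h, rfl⟩ := X_sub_C_dvd_of_forall_zero hz
      have h0 := right_ne_zero_of_mul hf
      refine ⟨h, h0, ?_, ?_⟩
      · have hX := one_le_totalDegree_X_sub_C i a
        rw [totalDegree_mul_of_isDomain (left_ne_zero_of_mul hf) h0] at hd
        omega
      · rw [zeros_mul, Set.union_comm]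
        congr 1
        ext p; simp [mem_zeros, sub_eq_zero]
    by_cases hv : ∃ a, vert a f = 0
    · obtain ⟨a, ha⟩ := hv
      obtain ⟨h, h0, hd, hz⟩ := step 0 a fun p hp => by
        rw [eq_vec p, hp]; exact vert_eq_zero_iff.mp ha _
      obtain ⟨g, U, V, hg, hgd, hU, hV, hgz⟩ := ih h h0 hd
      refine ⟨g, insert a U, V, hg, by omega, (Finset.card_insert_le _ _).trans (by omega),
        by omega, ?_⟩
      rw [hz, hgz]
      ext p
      simp only [Set.mem_union, Set.mem_ofPred_eq, Finset.mem_insert]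
      tauto
    by_cases hh : ∃ b, horiz b f = 0
    · obtain ⟨b, hb⟩ := hh
      obtain ⟨h, h0, hd, hz⟩ := step 1 b fun p hp => by
        rw [eq_vec p, hp]; exact horiz_eq_zero_iff.mp hb _
      obtain ⟨g, U, V, hg, hgd, hU, hV, hgz⟩ := ih h h0 hd
      refine ⟨g, U, insert b V, hg, by omega, by omega,
        (Finset.card_insert_le _ _).trans (by omega), ?_⟩
      rw [hz, hgz]
      ext p
      simp only [Set.mem_union, Set.mem_ofPred_eq, Finset.mem_insert]
      tauto
    push Not at hv hh
    exact ⟨f, ∅, ∅, ⟨hv, hh⟩, hd, by simp, by simp, by simp⟩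

section Lines

open Classical

variable {γ : Type*} {C : Finset γ}

theorem sum_card_inter_le {A : Finset ℝ} {U : γ → Finset ℝ} {M : ℕ}
    (h : ∀ a ∈ A, (C.filter fun c => a ∈ U c).card ≤ M) :
    ∑ c ∈ C, (A.filter fun a => a ∈ U c).card ≤ A.card * M := by
  have e := Finset.sum_card_bipartiteAbove_eq_sum_card_bipartiteBelow (s := C) (t := A)
    (fun c a => a ∈ U c)
  simp only [Finset.bipartiteAbove, Finset.bipartiteBelow] at e
  rw [e, ← smul_eq_mul]
  exact Finset.sum_le_card_nsmul _ _ _ h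

theorem card_filter_grid_le {A B U V : Finset ℝ} {c Z : Set Plane}
    (h : c = Z ∪ ({p | p 0 ∈ U} ∪ {p | p 1 ∈ V})) :
    ((grid A B).filter fun p => p ∈ c).card ≤ ((grid A B).filter fun p => p ∈ Z).card +
      ((A.filter fun a => a ∈ U).card * B.card + A.card * (B.filter fun b => b ∈ V).card) := by
  rw [← card_grid, ← card_grid]
  refine (Finset.card_le_card ?_).trans ((Finset.card_union_le _ _).trans
    (add_le_add le_rfl (Finset.card_union_le _ _)))
  intro p hp
  rw [h] at hp
  simp only [Finset.mem_filter, mem_grid, Finset.mem_union, Set.mem_union, Set.mem_ofPred_eq] at hp ⊢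
  tauto

theorem card_incidences (P : Finset Plane) (C : Finset (Set Plane)) :
    (incidences P C).card = ∑ c ∈ C, (P.filter fun p => p ∈ c).card := by
  rw [incidences, Finset.card_filter, Finset.sum_product_right]
  refine Finset.sum_congr rfl fun c _ => ?_
  rw [← Finset.card_filter]

end Lines

/-! ### The incidence bounds -/

/-- The main term `d^(2/3) M^(1/3) |P|^(2/3) |C|^(2/3)` of the bounds. -/
def mainTerm (d M P N : ℝ) : ℝ :=
  d ^ (2 / 3 : ℝ) * M ^ (1 / 3 : ℝ) * P ^ (2 / 3 : ℝ) * N ^ (2 / 3 : ℝ)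

theorem rpow_two_thirds_pow_three {x : ℝ} (hx : 0 ≤ x) : (x ^ (2 / 3 : ℝ)) ^ 3 = x ^ 2 := by
  rw [← Real.rpow_natCast, ← Real.rpow_mul hx]; norm_num

theorem rpow_one_third_pow_three {x : ℝ} (hx : 0 ≤ x) : (x ^ (1 / 3 : ℝ)) ^ 3 = x := by
  rw [← Real.rpow_natCast, ← Real.rpow_mul hx]; norm_num

theorem mainTerm_nonneg {d M P N : ℝ} (hd : 0 ≤ d) (hM : 0 ≤ M) (hP : 0 ≤ P) (hN : 0 ≤ N) :
    0 ≤ mainTerm d M P N := by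
  unfold mainTerm; positivity

theorem mainTerm_pow_three {d M P N : ℝ} (hd : 0 ≤ d) (hM : 0 ≤ M) (hP : 0 ≤ P) (hN : 0 ≤ N) :
    mainTerm d M P N ^ 3 = d ^ 2 * M * P ^ 2 * N ^ 2 := by
  rw [mainTerm, mul_pow, mul_pow, mul_pow, rpow_two_thirds_pow_three hd,
    rpow_one_third_pow_three hM, rpow_two_thirds_pow_three hP, rpow_two_thirds_pow_three hN]

/-- Optimizing the number of rows and columns in the cell bound. -/
theorem le_mainTerm_of_cell_bound {d M P N A I : ℝ} (hd : 1 ≤ d) (hM : 0 ≤ M) (hP : 0 ≤ P)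
    (hN : 0 < N) (hA : 0 ≤ A) (h1 : d ^ 4 * N ≤ M * P ^ 2) (h2 : M * P ^ 2 ≤ d * N * A ^ 3)
    (h : ∀ r : ℕ, 1 ≤ r → (r : ℝ) ≤ A →
      (r : ℝ) ^ 2 * I ≤ (r : ℝ) ^ 2 * (N * (4 * (r * d) + d ^ 2)) + 4 * (M * P ^ 2)) :
    I ≤ 21 * mainTerm d M P N := by
  have hd0 : 0 < d := by linarith
  have hdN : 0 < d * N := by positivity
  -- `ρ` is the real optimum, where `d * N * ρ = M * P ^ 2 / ρ ^ 2`. The hypotheses `h1` and `h2`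
  -- become `d ≤ ρ` and `ρ ≤ A`. Rounding down costs a factor of at most `2`, and `21 = 5 + 4 * 4`.
  obtain ⟨ρ, hρ⟩ : ∃ ρ, ρ = mainTerm d M P N / (d * N) := ⟨_, rfl⟩
  have hT : mainTerm d M P N = d * N * ρ := by rw [hρ]; field_simp
  have hρ0 : 0 ≤ ρ := by
    rw [hρ]; exact div_nonneg (mainTerm_nonneg hd0.le hM hP hN.le) hdN.le
  have hρ3 : d * N * ρ ^ 3 = M * P ^ 2 := by
    have := mainTerm_pow_three hd0.le hM hP hN.le
    rw [hT] at this
    have h' : (d * N) ^ 2 * (d * N * ρ ^ 3) = (d * N) ^ 2 * (M * P ^ 2) := by linear_combination this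
    exact mul_left_cancel₀ (by positivity) h'
  have hdρ : d ≤ ρ := by
    refine le_of_pow_le_pow_left₀ three_ne_zero hρ0 (le_of_mul_le_mul_left ?_ hdN)
    rw [hρ3]; linarith
  have hρA : ρ ≤ A := by
    refine le_of_pow_le_pow_left₀ three_ne_zero hA (le_of_mul_le_mul_left ?_ hdN)
    rw [hρ3]; exact h2
  obtain ⟨r, hr⟩ : ∃ r, r = ⌊ρ⌋₊ := ⟨_, rfl⟩
  have hr1 : 1 ≤ r := by rw [hr]; exact Nat.le_floor (by push_cast; linarith)
  have hrρ : (r : ℝ) ≤ ρ := by rw [hr]; exact Nat.floor_le hρ0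
  have hρr : ρ ≤ 2 * r := by
    have h3 := Nat.lt_floor_add_one ρ
    rw [← hr] at h3
    have : (1 : ℝ) ≤ r := by exact_mod_cast hr1
    linarith
  have hrpos : (0 : ℝ) < (r : ℝ) ^ 2 := by
    have : (1 : ℝ) ≤ r := by exact_mod_cast hr1
    positivity
  refine le_of_mul_le_mul_left ((h r hr1 (hrρ.trans hρA)).trans ?_) hrpos
  have e1 : N * (4 * (r * d) + d ^ 2) ≤ 5 * (d * N * ρ) := by
    have : 4 * (r * d) + d ^ 2 ≤ 5 * (d * ρ) := by nlinarith
    calc _ ≤ N * (5 * (d * ρ)) := mul_le_mul_of_nonneg_left this hN.le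
      _ = _ := by ring
  have e2 : ρ ^ 2 ≤ 4 * (r : ℝ) ^ 2 := by nlinarith
  have e3 : M * P ^ 2 ≤ (r : ℝ) ^ 2 * (4 * (d * N * ρ)) := by
    rw [← hρ3]
    calc d * N * ρ ^ 3 = (d * N * ρ) * ρ ^ 2 := by ring
      _ ≤ (d * N * ρ) * (4 * (r : ℝ) ^ 2) := by gcongr
      _ = _ := by ring
  have e4 := mul_le_mul_of_nonneg_left e1 hrpos.le
  rw [hT]
  nlinarith

section

open Classical

variable {γ : Type*} {C : Finset γ} {F : γ → Poly2} {A B : Finset ℝ} {d M : ℕ}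

theorem sum_card_grid_le_mainTerm (hC : C.Nonempty) (hd : 1 ≤ d)
    (hF : ∀ c ∈ C, NoAxisLine (F c) ∧ (F c).totalDegree ≤ d)
    (hM : ∀ p ∈ grid A B, ∀ q ∈ grid A B, p ≠ q →
      (C.filter fun c => p ∈ zeros (F c) ∧ q ∈ zeros (F c)).card ≤ M)
    (h1 : (d : ℝ) ^ 4 * C.card ≤ M * ((grid A B).card : ℝ) ^ 2) (hA : A.Nonempty)
    (hAB : A.card ≤ B.card) (h2 : (M : ℝ) * (B.card : ℝ) ^ 2 / A.card ≤ d * C.card) :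
    ((∑ c ∈ C, ((grid A B).filter fun p => p ∈ zeros (F c)).card : ℕ) : ℝ) ≤
      21 * mainTerm d M (grid A B).card C.card := by
  have hA0 : (0 : ℝ) < A.card := by exact_mod_cast hA.card_pos
  refine le_mainTerm_of_cell_bound (A := A.card) (by exact_mod_cast hd) (Nat.cast_nonneg _)
    (Nat.cast_nonneg _) (by exact_mod_cast hC.card_pos) hA0.le h1 ?_ ?_
  · rw [div_le_iff₀ hA0] at h2
    rw [card_grid]; push_cast
    calc (M : ℝ) * (A.card * B.card) ^ 2 = (M * (B.card : ℝ) ^ 2) * (A.card : ℝ) ^ 2 := by ring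
      _ ≤ (d * C.card * A.card) * (A.card : ℝ) ^ 2 := by gcongr
      _ = _ := by ring
  · intro r hr hrA
    have hrA' : r ≤ A.card := by exact_mod_cast hrA
    exact_mod_cast sum_card_grid_le hF hM hr hrA' (hrA'.trans hAB)

theorem le_mainTerm_of_pow_three_le {d M P N I : ℝ} (hd : 0 ≤ d) (hM : 0 ≤ M) (hP : 0 ≤ P)
    (hN : 0 ≤ N) (h : I ^ 3 ≤ d ^ 2 * M * P ^ 2 * N ^ 2) : I ≤ mainTerm d M P N := by
  refine le_of_pow_le_pow_left₀ three_ne_zero (mainTerm_nonneg hd hM hP hN) ?_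
  rwa [mainTerm_pow_three hd hM hP hN]

/-- A multiple of `n` bounded in two ways by the numbers of lines and of curves. -/
theorem mul_le_mainTerm {n L d M N : ℝ} (hn : 0 ≤ n) (hL : 0 ≤ L) (hd : 0 ≤ d) (hM : 0 ≤ M)
    (hN : 0 ≤ N) (h1 : L ≤ n * M) (h2 : L ≤ N * d) : n * L ≤ mainTerm d M (n * n) N := by
  refine le_mainTerm_of_pow_three_le hd hM (by positivity) hN ?_
  calc (n * L) ^ 3 = n ^ 3 * (L * L ^ 2) := by ring
    _ ≤ n ^ 3 * ((n * M) * (N * d) ^ 2) := by gcongr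
    _ = _ := by ring

/-- With `D = d ^ 2 * |C|`, Cauchy–Schwarz becomes `I ^ 2 ≤ D * I + D ^ 2`, which rules out `I > 2 *
D`. -/
theorem sum_card_le_of_lt {Z : γ → Set Plane} {P : Finset Plane} (hd : 1 ≤ d)
    (hM : ∀ p ∈ P, ∀ q ∈ P, p ≠ q → (C.filter fun c => p ∈ Z c ∧ q ∈ Z c).card ≤ M)
    (h : M * P.card ^ 2 ≤ d ^ 4 * C.card) :
    ∑ c ∈ C, (P.filter fun p => p ∈ Z c).card ≤ 2 * (d ^ 2 * C.card) := by
  have hs := sq_sum_card_le hM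
  generalize ∑ c ∈ C, (P.filter fun p => p ∈ Z c).card = I at *
  have h1 : C.card ≤ d ^ 2 * C.card := Nat.le_mul_of_pos_left _ (by positivity)
  have h2 : C.card * (M * P.card ^ 2) ≤ (d ^ 2 * C.card) ^ 2 :=
    (Nat.mul_le_mul_left _ h).trans (by ring_nf; rfl)
  generalize d ^ 2 * C.card = D at *
  have h3 : C.card * I ≤ D * I := Nat.mul_le_mul_right _ h1
  by_contra! hlt
  nlinarith

/-- The incidence bound on a square grid with one equation per curve split into axis-parallel lines
and a remainder. -/
theorem sum_card_square_grid_le {Z : γ → Set Plane} {U V : γ → Finset ℝ} (hC : C.Nonempty)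
    (hd : 1 ≤ d) (hAB : A.card = B.card)
    (hF : ∀ c ∈ C, NoAxisLine (F c) ∧ (F c).totalDegree ≤ d)
    (hU : ∀ c ∈ C, (U c).card ≤ d) (hV : ∀ c ∈ C, (V c).card ≤ d)
    (hZ : ∀ c ∈ C, Z c = zeros (F c) ∪ ({p | p 0 ∈ U c} ∪ {p | p 1 ∈ V c}))
    (hM : ∀ p ∈ grid A B, ∀ q ∈ grid A B, p ≠ q →
      (C.filter fun c => p ∈ Z c ∧ q ∈ Z c).card ≤ M) :
    ((∑ c ∈ C, ((grid A B).filter fun p => p ∈ Z c).card : ℕ) : ℝ) ≤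
      23 * (mainTerm d M (grid A B).card C.card + d ^ 2 * C.card) := by
  have hT := mainTerm_nonneg (Nat.cast_nonneg (α := ℝ) d) (Nat.cast_nonneg M)
    (Nat.cast_nonneg (grid A B).card) (Nat.cast_nonneg C.card)
  have hD : (0 : ℝ) ≤ (d : ℝ) ^ 2 * C.card := by positivity
  -- A grid of at most one point is set aside: the multiplicity bound for lines needs two grid
  -- points on each.
  rcases Nat.lt_or_ge 1 A.card with hA | hA
  swap
  · have hP : (grid A B).card ≤ 1 := by
      rw [card_grid, ← hAB]; exact Nat.mul_le_mul hA hA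
    have h1 : ∑ c ∈ C, ((grid A B).filter fun p => p ∈ Z c).card ≤ d ^ 2 * C.card := by
      refine (Finset.sum_le_card_nsmul _ _ 1 fun c _ => (Finset.card_filter_le _ _).trans hP).trans ?_
      rw [smul_eq_mul, mul_one]
      exact Nat.le_mul_of_pos_left _ (by positivity)
    have h2 : ((∑ c ∈ C, ((grid A B).filter fun p => p ∈ Z c).card : ℕ) : ℝ) ≤
      (d : ℝ) ^ 2 * C.card := by exact_mod_cast h1
    linarith
  rcases le_total (M * (grid A B).card ^ 2) (d ^ 4 * C.card) with hle | hle
  · have h2 : ((∑ c ∈ C, ((grid A B).filter fun p => p ∈ Z c).card : ℕ) : ℝ) ≤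
      2 * ((d : ℝ) ^ 2 * C.card) := by exact_mod_cast sum_card_le_of_lt hd hM hle
    linarith
  have hMF : ∀ p ∈ grid A B, ∀ q ∈ grid A B, p ≠ q →
      (C.filter fun c => p ∈ zeros (F c) ∧ q ∈ zeros (F c)).card ≤ M := by
    refine fun p hp q hq hpq => (Finset.card_le_card fun c hc => ?_).trans (hM p hp q hq hpq)
    rw [Finset.mem_filter] at hc ⊢
    rw [hZ c hc.1]
    exact ⟨hc.1, Or.inl hc.2.1, Or.inl hc.2.2⟩
  have hrest : ((∑ c ∈ C, ((grid A B).filter fun p => p ∈ zeros (F c)).card : ℕ) : ℝ) ≤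
      21 * mainTerm d M (grid A B).card C.card := by
    have hA0 : A.Nonempty := Finset.card_pos.mp (by omega)
    -- On a square grid the last size condition of (i) reads `M * |A| ≤ d * |C|`. When it fails, the
    -- trivial bound `|A| * |C| * d` is already below the main term.
    rcases le_total (M * A.card) (d * C.card) with hMA | hMA
    · refine sum_card_grid_le_mainTerm hC hd hF hMF (by exact_mod_cast hle) hA0 hAB.le ?_
      have hA1 : (0 : ℝ) < A.card := by exact_mod_cast hA0.card_pos
      rw [div_le_iff₀ hA1, ← hAB]
      have : (M : ℝ) * A.card ≤ d * C.card := by exact_mod_cast hMA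
      nlinarith
    · have h1 : ∑ c ∈ C, ((grid A B).filter fun p => p ∈ zeros (F c)).card ≤
          A.card * (C.card * d) := by
        refine (Finset.sum_le_card_nsmul _ _ _ fun c hc =>
          card_zeros_grid_le (hF c hc).1 (hF c hc).2).trans (le_of_eq ?_)
        rw [smul_eq_mul]; ring
      have h2 : ((∑ c ∈ C, ((grid A B).filter fun p => p ∈ zeros (F c)).card : ℕ) : ℝ) ≤
          (A.card : ℝ) * (C.card * d) := by exact_mod_cast h1
      have hMA' : (d : ℝ) * C.card ≤ M * A.card := by exact_mod_cast hMA
      have h3 := mul_le_mainTerm (n := A.card) (L := C.card * d) (d := d) (M := M) (N := C.card)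
        (by positivity) (by positivity) (by positivity) (by positivity) (by positivity)
        (by linarith) le_rfl
      have hP : ((grid A B).card : ℝ) = A.card * A.card := by
        rw [card_grid, ← hAB, Nat.cast_mul]
      rw [← hP] at h3
      linarith
  have hLU : ∑ c ∈ C, (A.filter fun a => a ∈ U c).card ≤ A.card * M := by
    obtain ⟨b, hb, b', hb', hbb⟩ := Finset.one_lt_card.mp (hAB ▸ hA)
    refine sum_card_inter_le fun a ha => ?_
    refine (Finset.card_le_card fun c hc => ?_).trans (hM ![a, b] (mem_grid.mpr ⟨ha, hb⟩) ![a, b']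
      (mem_grid.mpr ⟨ha, hb'⟩) fun h => hbb (congrFun h 1))
    rw [Finset.mem_filter] at hc ⊢
    rw [hZ c hc.1]
    exact ⟨hc.1, Or.inr (Or.inl hc.2), Or.inr (Or.inl hc.2)⟩
  have hLV : ∑ c ∈ C, (B.filter fun b => b ∈ V c).card ≤ A.card * M := by
    obtain ⟨a, ha, a', ha', haa⟩ := Finset.one_lt_card.mp hA
    rw [hAB]
    refine sum_card_inter_le fun b hb => ?_
    refine (Finset.card_le_card fun c hc => ?_).trans (hM ![a, b] (mem_grid.mpr ⟨ha, hb⟩) ![a', b]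
      (mem_grid.mpr ⟨ha', hb⟩) fun h => haa (congrFun h 0))
    rw [Finset.mem_filter] at hc ⊢
    rw [hZ c hc.1]
    exact ⟨hc.1, Or.inr (Or.inr hc.2), Or.inr (Or.inr hc.2)⟩
  have hcard : ∀ S T : Finset ℝ, (S.filter fun a => a ∈ T).card ≤ T.card := fun S T =>
    Finset.card_le_card fun a ha => (Finset.mem_filter.mp ha).2
  have hLU' : ∑ c ∈ C, (A.filter fun a => a ∈ U c).card ≤ C.card * d :=
    Finset.sum_le_card_nsmul _ _ _ fun c hc => (hcard _ _).trans (hU c hc)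
  have hLV' : ∑ c ∈ C, (B.filter fun b => b ∈ V c).card ≤ C.card * d :=
    Finset.sum_le_card_nsmul _ _ _ fun c hc => (hcard _ _).trans (hV c hc)
  have hsum : ∑ c ∈ C, ((grid A B).filter fun p => p ∈ Z c).card ≤
      ∑ c ∈ C, ((grid A B).filter fun p => p ∈ zeros (F c)).card +
      (A.card * (∑ c ∈ C, (A.filter fun a => a ∈ U c).card) +
        A.card * ∑ c ∈ C, (B.filter fun b => b ∈ V c).card) := by
    rw [Finset.mul_sum, Finset.mul_sum, ← Finset.sum_add_distrib, ← Finset.sum_add_distrib]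
    refine Finset.sum_le_sum fun c hc => (card_filter_grid_le (hZ c hc)).trans (le_of_eq ?_)
    rw [← hAB, mul_comm _ A.card]
  generalize ∑ c ∈ C, ((grid A B).filter fun p => p ∈ Z c).card = I at *
  generalize ∑ c ∈ C, ((grid A B).filter fun p => p ∈ zeros (F c)).card = I₀ at *
  generalize ∑ c ∈ C, (A.filter fun a => a ∈ U c).card = L₁ at *
  generalize ∑ c ∈ C, (B.filter fun b => b ∈ V c).card = L₂ at *
  have hP : ((grid A B).card : ℝ) = A.card * A.card := by rw [card_grid, ← hAB]; push_cast; rfl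
  have m1 := mul_le_mainTerm (n := A.card) (L := L₁) (d := d) (M := M) (N := C.card)
    (by positivity) (by positivity) (by positivity) (by positivity) (by positivity)
    (by exact_mod_cast hLU) (by exact_mod_cast hLU')
  have m2 := mul_le_mainTerm (n := A.card) (L := L₂) (d := d) (M := M) (N := C.card)
    (by positivity) (by positivity) (by positivity) (by positivity) (by positivity)
    (by exact_mod_cast hLV) (by exact_mod_cast hLV')
  rw [← hP] at m1 m2
  -- The constant is `23 = 21 + 1 + 1`: the remainder, the vertical lines and the horizontal lines.
  have hsum' : (I : ℝ) ≤ I₀ + (A.card * L₁ + A.card * L₂) := by exact_mod_cast hsum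
  linarith

end

theorem incidences_le_of_no_axis_line {A B : Finset ℝ} {C : Finset (Set Plane)} {d M : ℕ}
    (hC : ∀ c ∈ C, IsRealCurve c ∧ curveDegree c ≤ d) (hM : AtMostThroughTwo (grid A B) C M)
    (hl : ∀ c ∈ C, ¬ ContainsAxisParallelLine c)
    (h1 : (d : ℝ) ^ 4 * C.card ≤ M * ((grid A B).card : ℝ) ^ 2)
    (hAB : A.card ≤ B.card) (h2 : (M : ℝ) * (B.card : ℝ) ^ 2 / A.card ≤ d * C.card) :
    ((incidences (grid A B) C).card : ℝ) ≤ 21 * mainTerm d M (grid A B).card C.card := by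
  classical
  have hT := mainTerm_nonneg (Nat.cast_nonneg (α := ℝ) d) (Nat.cast_nonneg M)
    (Nat.cast_nonneg (grid A B).card) (Nat.cast_nonneg C.card)
  rw [card_incidences]
  rcases C.eq_empty_or_nonempty with rfl | hne
  · simpa using hT
  -- For empty `A` the quotient in `h2` is `0` by convention, so `h2` is void; there are no
  -- incidences either.
  rcases A.eq_empty_or_nonempty with rfl | hA
  · have : grid ∅ B = ∅ := by rw [← Finset.card_eq_zero, card_grid]; simp
    rw [this] at hT ⊢
    simpa using hT
  have hF : ∀ c ∈ C, ∃ f : Poly2, c = zeros f ∧ NoAxisLine f ∧ f.totalDegree ≤ d ∧ 1 ≤ d := by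
    intro c hc
    obtain ⟨f, -, hcf, hdeg, hpos⟩ := (hC c hc).1.exists_poly
    have := (hC c hc).2
    exact ⟨f, hcf, noAxisLine_of_not_contains (hcf ▸ hl c hc), by omega, by omega⟩
  choose! F hZ hnl hdeg hd using hF
  have hd1 : 1 ≤ d := hd _ hne.choose_spec
  have hMF : ∀ p ∈ grid A B, ∀ q ∈ grid A B, p ≠ q →
      (C.filter fun c => p ∈ zeros (F c) ∧ q ∈ zeros (F c)).card ≤ M := by
    refine fun p hp q hq hpq => (Finset.card_le_card fun c hc => ?_).trans (hM p hp q hq hpq)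
    rw [Finset.mem_filter] at hc ⊢
    rwa [← hZ c hc.1] at hc
  have := sum_card_grid_le_mainTerm hne hd1 (fun c hc => ⟨hnl c hc, hdeg c hc⟩) hMF h1 hA hAB h2
  refine le_trans (le_of_eq ?_) this
  congr 1
  refine Finset.sum_congr rfl fun c hc => ?_
  congr 1
  ext p
  rw [Finset.mem_filter, Finset.mem_filter, ← hZ c hc]

theorem incidences_le_of_card_eq {A B : Finset ℝ} {C : Finset (Set Plane)} {d M : ℕ}
    (hAB : A.card = B.card) (hC : ∀ c ∈ C, IsRealCurve c ∧ curveDegree c ≤ d)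
    (hM : AtMostThroughTwo (grid A B) C M) :
    ((incidences (grid A B) C).card : ℝ) ≤
      23 * (mainTerm d M (grid A B).card C.card + d ^ 2 * C.card) := by
  classical
  rw [card_incidences]
  rcases C.eq_empty_or_nonempty with rfl | hne
  · have := mainTerm_nonneg (Nat.cast_nonneg (α := ℝ) d) (Nat.cast_nonneg M)
      (Nat.cast_nonneg (grid A B).card) (le_refl 0)
    simpa using this
  have hF : ∀ c ∈ C, ∃ (g : Poly2) (U V : Finset ℝ), NoAxisLine g ∧ g.totalDegree ≤ d ∧
      U.card ≤ d ∧ V.card ≤ d ∧ c = zeros g ∪ ({p | p 0 ∈ U} ∪ {p | p 1 ∈ V}) ∧ 1 ≤ d := by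
    intro c hc
    obtain ⟨f, hf0, hcf, hdeg, hpos⟩ := (hC c hc).1.exists_poly
    have := (hC c hc).2
    obtain ⟨g, U, V, h1, h2, h3, h4, h5⟩ := exists_split_lines d f hf0 (by omega)
    exact ⟨g, U, V, h1, h2, h3, h4, hcf.trans h5, by omega⟩
  choose! F U V hnl hdeg hU hV hZ hd using hF
  exact sum_card_square_grid_le (Z := id) hne (hd _ hne.choose_spec) hAB
    (fun c hc => ⟨hnl c hc, hdeg c hc⟩) hU hV hZ hM

end RealIncidence

end

theorem mainTheorem11 :
    (∃ K : ℝ, 0 < K ∧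
      ∀ (A B : Finset ℝ) (C : Finset (Set RealIncidence.Plane)) (d M : ℕ),
        (∀ c ∈ C, RealIncidence.IsRealCurve c ∧ RealIncidence.curveDegree c ≤ d) →
        RealIncidence.AtMostThroughTwo (RealIncidence.grid A B) C M →
        (∀ c ∈ C, ¬ RealIncidence.ContainsAxisParallelLine c) →
        (d : ℝ) ^ 4 * (C.card : ℝ) ≤ (M : ℝ) * ((RealIncidence.grid A B).card : ℝ) ^ 2 →
        A.card ≤ B.card →
        (M : ℝ) * (B.card : ℝ) ^ 2 / (A.card : ℝ) ≤ (d : ℝ) * (C.card : ℝ) →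
        ((RealIncidence.incidences (RealIncidence.grid A B) C).card : ℝ) ≤
          K * ((d : ℝ) ^ (2 / 3 : ℝ) * (M : ℝ) ^ (1 / 3 : ℝ) *
            ((RealIncidence.grid A B).card : ℝ) ^ (2 / 3 : ℝ) *
            (C.card : ℝ) ^ (2 / 3 : ℝ))) ∧
    (∃ K : ℝ, 0 < K ∧
      ∀ (A B : Finset ℝ) (C : Finset (Set RealIncidence.Plane)) (d M : ℕ),
        A.card = B.card →
        (∀ c ∈ C, RealIncidence.IsRealCurve c ∧ RealIncidence.curveDegree c ≤ d) →
        RealIncidence.AtMostThroughTwo (RealIncidence.grid A B) C M →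
        ((RealIncidence.incidences (RealIncidence.grid A B) C).card : ℝ) ≤
          K * ((d : ℝ) ^ (2 / 3 : ℝ) * (M : ℝ) ^ (1 / 3 : ℝ) *
              ((RealIncidence.grid A B).card : ℝ) ^ (2 / 3 : ℝ) *
              (C.card : ℝ) ^ (2 / 3 : ℝ) +
            (M : ℝ) * (Real.log (M : ℝ) + Real.log (d : ℝ)) *
              ((RealIncidence.grid A B).card : ℝ) +
            (d : ℝ) ^ 2 * (C.card : ℝ))) := by
  refine ⟨⟨21, by norm_num, ?_⟩, ⟨23, by norm_num, ?_⟩⟩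
  · intro A B C d M hC hM hl h1 hAB h2
    exact RealIncidence.incidences_le_of_no_axis_line hC hM hl h1 hAB h2
  · intro A B C d M hAB hC hM
    refine (RealIncidence.incidences_le_of_card_eq hAB hC hM).trans ?_
    refine mul_le_mul_of_nonneg_left ?_ (by norm_num)
    have hlog : 0 ≤ (M : ℝ) * (Real.log (M : ℝ) + Real.log (d : ℝ)) *
        ((RealIncidence.grid A B).card : ℝ) :=
      mul_nonneg (mul_nonneg (Nat.cast_nonneg _)
        (add_nonneg (Real.log_natCast_nonneg _) (Real.log_natCast_nonneg _))) (Nat.cast_nonneg _)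
    rw [RealIncidence.mainTerm]
    linarith
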